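/- Let $N\ge 0$ and let $E=\mathbf R^N\times\mathbf R\to\mathbf R^N$ be the trivial line bundle. Its infinite jet bundle $J^\infty E$ has coordinates $x^i$ ($1\le i\le N$) and $u_J$, where $J=(j_1,\dots,j_N)$ runs over all multi-indices of non-negative integers, $|J|=j_1+\cdots+j_N$. Let $\mathrm{Loc}(E)$ be the algebra of local functions, i.e. smooth functions of finitely many of these coordinates. Let $$\frac{d}{dx^i}=\frac{\partial}{\partial x^i}+\sum_J u_{iJ}\frac{\partial}{\partial u_J}$$ be the total derivatives, where $iJ$ is $J$ with its $i$-th entry increased by $1$, and put $\left(\frac{d}{d\mathbf x}\right)^I=\left(\frac{d}{dx^1}\right)^{i_1}\cdots\left(\frac{d}{dx^N}\right)^{i_N}$ for $I=(i_1,\dots,i_N)$, and $\left(\frac{\partial}{\partial\mathbf u}\right)^\alpha=\prod_J\frac{\partial^{\alpha(J)}}{\partial u_J^{\alpha(J)}}$ for finitely supported $\alpha$ with values in the non-negative integers. A linear map $A:\mathrm{Loc}(E)\to\mathrm{Loc}(E)$ is a local differential operator (LDO) if $$A(f)=\sum_{I,\alpha}p_{I,\alpha}\left(\frac{d}{d\mathbf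 x}\right)^I\left(\frac{\partial}{\partial\mathbf u}\right)^\alpha f,\qquad p_{I,\alpha}\in\mathrm{Loc}(E),$$ where for each $n$ only finitely many $p_{I,\alpha}\neq0$ have $\max\{|J| : \alpha(J)\ne0\}\le n$ (the maximum is $0$ for $\alpha=0$). Its characteristic is the LDO $$\chi(A)=\sum_{I,\alpha}(-1)^{|I|}\left(\left(\frac{d}{d\mathbf x}\right)^I p_{I,\alpha}\right)\left(\frac{\partial}{\partial\mathbf u}\right)^\alpha .$$ Let $\Omega^{k,0}$ be the free $\mathrm{Loc}(E)$-module on the forms $dx^{i_1}\wedge\cdots\wedge dx^{i_k}$, $i_1<\cdots<i_k$, and let $d_H\omega=\sum_i dx^i\wedge\frac{d}{dx^i}\omega$ be the horizontal differential $\Omega^{k,0}\to\Omega^{k+1,0}$. A linear map $\Omega^{k,0}\to\Omega^{l,0}$ is an LDO if its matrix elements in these bases are LDOs on $\mathrm{Loc}(E)$. Through $f\mapsto f\,dx^1\wedge\cdots\wedge dx^N$, operators on $\Omega^{N,0}$ are identified with operators on $\mathrm{Loc}(E)$. **Corollary.** Let $A_N:\Omega^{N,0}\to\Omega^{N,0}$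 be an LDO. There is a sequence of LDOs $A_s:\Omega^{s,0}\to\Omega^{s,0}$, $0\le s\le N$, which ends in the given $A_N$ and satisfies $d_HA_s=A_{s+1}d_H$ for $0\le s<N$, if and only if $$\chi\left(A_N\circ\frac{d}{dx^i}\right)=0\qquad\text{for } 1\le i\le N.$$ In this case the sequence can be chosen so that, for $0\le s\le N-2$, $A_s$ is $\chi(A_N)$ acting diagonally: $A_s(f\,dx^{i_1}\wedge\cdots\wedge dx^{i_s})=\chi(A_N)(f)\,dx^{i_1}\wedge\cdots\wedge dx^{i_s}$. -/

import Mathlib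

open scoped ContDiff

namespace VarBicomplex

noncomputable section

/-- Multi-indices `J = (j_1, …, j_N)`. -/
abbrev MultiIndex (N : ℕ) : Type := Fin N → ℕ

/-- The order `|J| = j_1 + ⋯ + j_N`. -/
def MultiIndex.order {N : ℕ} (J : MultiIndex N) : ℕ := ∑ i, J i

/-- The multi-index `iJ`: one more in the `i`-th slot. -/
def MultiIndex.shift {N : ℕ} (i : Fin N) (J : MultiIndex N) : MultiIndex N := J + Pi.single i 1

/-- The coordinates of the infinite jet bundle of `ℝ^N × ℝ → ℝ^N`: `Sum.inl i` is `x^i` and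
`Sum.inr J` is `u_J`. -/
abbrev JetCoord (N : ℕ) : Type := Fin N ⊕ MultiIndex N

/-- The points of the infinite jet bundle, given by their coordinates. -/
abbrev Jet (N : ℕ) : Type := JetCoord N → ℝ

/-- `f` is a local function: a smooth function of finitely many of the coordinates
`x^i`, `u_J`. (Finitely many coordinates all live on some `J^k E`, which has itself only finitely
many coordinates, so these are the pullbacks of the smooth functions on the `J^k E`.) -/
def IsLocal {N : ℕ} (f : Jet N → ℝ) : Prop :=
  ∃ (S : Finset (JetCoord N)) (g : (S → ℝ) → ℝ), ContDiff ℝ ∞ g ∧ ∀ p, f p = g (fun c => p c)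

theorem IsLocal.exists_of_subset {N : ℕ} {S : Finset (JetCoord N)} {g : (S → ℝ) → ℝ}
    (hg : ContDiff ℝ ∞ g) {T : Finset (JetCoord N)} (h : S ⊆ T) :
    ∃ g' : (T → ℝ) → ℝ, ContDiff ℝ ∞ g' ∧
      ∀ p : Jet N, g (fun c => p c) = g' (fun c => p c) :=
  ⟨fun y => g (fun c => y ⟨c.1, h c.2⟩), hg.comp (by fun_prop), fun _ => rfl⟩

/-- The algebra `Loc(E)` of local functions. -/
def Loc (N : ℕ) : Subalgebra ℝ (Jet N → ℝ) where
  carrier := {f | IsLocal f}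
  mul_mem' := by
    rintro f f' ⟨S, g, hg, h⟩ ⟨S', g', hg', h'⟩
    obtain ⟨k, hk, e⟩ := IsLocal.exists_of_subset hg (Finset.subset_union_left (s₂ := S'))
    obtain ⟨k', hk', e'⟩ := IsLocal.exists_of_subset hg' (Finset.subset_union_right (s₁ := S))
    exact ⟨S ∪ S', fun y => k y * k' y, hk.mul hk', fun p => by simp [h, h', e, e']⟩
  add_mem' := by
    rintro f f' ⟨S, g, hg, h⟩ ⟨S', g', hg', h'⟩
    obtain ⟨k, hk, e⟩ := IsLocal.exists_of_subset hg (Finset.subset_union_left (s₂ := S'))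
    obtain ⟨k', hk', e'⟩ := IsLocal.exists_of_subset hg' (Finset.subset_union_right (s₁ := S))
    exact ⟨S ∪ S', fun y => k y + k' y, hk.add hk', fun p => by simp [h, h', e, e']⟩
  algebraMap_mem' r := ⟨∅, fun _ => r, contDiff_const, fun _ => rfl⟩

/-- The coordinate functions `x^i` and `u_J`. -/
def coord {N : ℕ} (c : JetCoord N) : Loc N :=
  ⟨fun p => p c, {c}, fun y => y ⟨c, by simp⟩, by fun_prop, fun _ => rfl⟩

/-- The partial derivative with respect to the coordinate `c`, for functions on the jet space. -/
def pderivFun {N : ℕ} (c : JetCoord N) (f : Jet N → ℝ) : Jet N → ℝ :=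
  fun p => deriv (fun t => f (Function.update p c t)) (p c)

theorem hasDerivAt_update {N : ℕ} {S : Finset (JetCoord N)} {g : (S → ℝ) → ℝ}
    (hg : ContDiff ℝ ∞ g) (c : S) (p : Jet N) :
    HasDerivAt (fun t => g (fun d => Function.update p c t d))
      (fderiv ℝ g (fun d => p d) (Pi.single c 1)) (p c) := by
  have h1 : HasDerivAt (fun t : ℝ => (fun d : S => Function.update p (c : JetCoord N) t d))
      (Pi.single c 1) (p c) := by
    rw [hasDerivAt_pi]
    intro d
    by_cases hd : d = c
    · subst hd
      simpa using hasDerivAt_id' (p d)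
    · have : (d : JetCoord N) ≠ c := fun h => hd (Subtype.ext h)
      simpa [Function.update_of_ne this, Pi.single_eq_of_ne hd] using
        hasDerivAt_const (p c) (p d)
  have h2 : HasFDerivAt g (fderiv ℝ g (fun d => p d))
      (fun d : S => Function.update p (c : JetCoord N) (p c) d) := by
    rw [Function.update_eq_self]
    exact (hg.differentiable (by simp) _).hasFDerivAt
  exact h2.comp_hasDerivAt _ h1

theorem pderivFun_of_mem {N : ℕ} {S : Finset (JetCoord N)} {g : (S → ℝ) → ℝ}
    (hg : ContDiff ℝ ∞ g) {f : Jet N → ℝ} (hf : ∀ p, f p = g (fun c => p c)) (c : S) (p : Jet N) :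
    pderivFun c f p = fderiv ℝ g (fun d => p d) (Pi.single c 1) := by
  obtain rfl : f = fun p => g (fun c => p c) := funext hf
  exact (hasDerivAt_update hg c p).deriv

theorem pderivFun_of_notMem {N : ℕ} {S : Finset (JetCoord N)} {g : (S → ℝ) → ℝ}
    {f : Jet N → ℝ} (hf : ∀ p, f p = g (fun c => p c)) {c : JetCoord N} (hc : c ∉ S) :
    pderivFun c f = 0 := by
  obtain rfl : f = fun p => g (fun c => p c) := funext hf
  funext p
  have : (fun t => g (fun d : S => Function.update p c t d)) = fun _ => g (fun d => p d) := by
    funext t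
    congr 1
    funext d
    exact Function.update_of_ne (fun h : (d : JetCoord N) = c => hc (h ▸ d.2)) _ _
  simp [pderivFun, this]

theorem contDiff_fderiv_single {N : ℕ} {S : Finset (JetCoord N)} {g : (S → ℝ) → ℝ}
    (hg : ContDiff ℝ ∞ g) (c : S) :
    ContDiff ℝ ∞ (fun y => fderiv ℝ g y (Pi.single c 1)) :=
  (hg.fderiv_right (m := ∞) (by simp)).clm_apply contDiff_const

theorem IsLocal.pderivFun {N : ℕ} {f : Jet N → ℝ} (hf : IsLocal f) (c : JetCoord N) :
    IsLocal (pderivFun c f) := by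
  obtain ⟨S, g, hg, h⟩ := hf
  by_cases hc : c ∈ S
  · exact ⟨S, _, contDiff_fderiv_single hg ⟨c, hc⟩, fun p => pderivFun_of_mem hg h ⟨c, hc⟩ p⟩
  · rw [pderivFun_of_notMem h hc]
    exact (Loc N).zero_mem

theorem IsLocal.differentiableAt {N : ℕ} {f : Jet N → ℝ} (hf : IsLocal f) (c : JetCoord N)
    (p : Jet N) : DifferentiableAt ℝ (fun t => f (Function.update p c t)) (p c) := by
  obtain ⟨S, g, hg, h⟩ := hf
  obtain ⟨g', hg', e⟩ := IsLocal.exists_of_subset hg (Finset.subset_insert c S)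
  obtain rfl : f = fun p => g' (fun c => p c) := funext fun p => (h p).trans (e p)
  exact (hasDerivAt_update hg' ⟨c, by simp⟩ p).differentiableAt

/-- The partial derivative with respect to the coordinate `c`, as a linear operator on `Loc(E)`:
`pderiv (Sum.inl i) = ∂/∂x^i` and `pderiv (Sum.inr J) = ∂/∂u_J`. -/
def pderiv {N : ℕ} (c : JetCoord N) : Module.End ℝ (Loc N) where
  toFun f := ⟨pderivFun c f, f.2.pderivFun c⟩
  map_add' f g := by
    ext p
    exact deriv_add (f.2.differentiableAt c p) (g.2.differentiableAt c p)
  map_smul' r f := by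
    ext p
    exact deriv_const_mul r (f.2.differentiableAt c p)

theorem pderiv_commute {N : ℕ} (c d : JetCoord N) : Commute (pderiv c) (pderiv d) := by
  refine LinearMap.ext fun f => Subtype.ext (funext fun p => ?_)
  obtain ⟨f, S, g, hg, h⟩ := f
  obtain ⟨k, hk, e⟩ := IsLocal.exists_of_subset hg
    ((Finset.subset_insert c S).trans (Finset.subset_insert d _))
  have hf : ∀ p, f p = k (fun c => p c) := fun p => (h p).trans (e p)
  change pderivFun c (pderivFun d f) p = pderivFun d (pderivFun c f) p
  have hc : c ∈ insert d (insert c S) := by simp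
  have hd : d ∈ insert d (insert c S) := by simp
  rw [pderivFun_of_mem (contDiff_fderiv_single hk ⟨d, hd⟩)
      (fun p => pderivFun_of_mem hk hf ⟨d, hd⟩ p) ⟨c, hc⟩ p,
    pderivFun_of_mem (contDiff_fderiv_single hk ⟨c, hc⟩)
      (fun p => pderivFun_of_mem hk hf ⟨c, hc⟩ p) ⟨d, hd⟩ p]
  set y : (insert d (insert c S) : Finset (JetCoord N)) → ℝ := fun c => p c
  have hdiff : DifferentiableAt ℝ (fderiv ℝ k) y :=
    (hk.fderiv_right (m := ∞) (by simp)).differentiable (by simp) y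
  have hsymm : IsSymmSndFDerivAt ℝ k y :=
    hk.contDiffAt.isSymmSndFDerivAt (by
      rw [minSmoothness_of_isRCLikeNormedField]
      exact WithTop.coe_le_coe.2 (le_top : (2 : ℕ∞) ≤ ⊤))
  have key : ∀ v w, fderiv ℝ (fun y => fderiv ℝ k y v) y w = fderiv ℝ (fderiv ℝ k) y w v := by
    intro v w
    rw [fderiv_clm_apply hdiff (differentiableAt_const v)]
    simp
  rw [key, key]
  exact hsymm.eq _ _

/-- A local function has only finitely many nonzero partial derivatives. -/
theorem exists_finset_pderiv {N : ℕ} (f : Loc N) :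
    ∃ S : Finset (JetCoord N), ∀ c ∉ S, pderiv c f = 0 := by
  obtain ⟨f, S, g, hg, h⟩ := f
  exact ⟨S, fun c hc => Subtype.ext (pderivFun_of_notMem h hc)⟩

theorem finite_support_totalSum {N : ℕ} (i : Fin N) (f : Loc N) :
    (Function.support fun J : MultiIndex N =>
      coord (Sum.inr (J.shift i)) * pderiv (Sum.inr J) f).Finite := by
  obtain ⟨S, hS⟩ := exists_finset_pderiv f
  refine (S.finite_toSet.preimage (Sum.inr_injective (α := Fin N)).injOn).subset fun J hJ => ?_
  by_contra h
  exact hJ (by simp [hS _ h])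

/-- The total derivative `d/dx^i = ∂/∂x^i + ∑_J u_{iJ} ∂/∂u_J`. -/
def totalDeriv {N : ℕ} (i : Fin N) : Module.End ℝ (Loc N) where
  toFun f := pderiv (Sum.inl i) f +
    ∑ᶠ J : MultiIndex N, coord (Sum.inr (J.shift i)) * pderiv (Sum.inr J) f
  map_add' f g := by
    simp only [map_add, mul_add]
    rw [finsum_add_distrib (finite_support_totalSum i f) (finite_support_totalSum i g)]
    abel
  map_smul' r f := by
    simp only [map_smul, mul_smul_comm, RingHom.id_apply, smul_add]
    rw [smul_finsum' r (finite_support_totalSum i f)]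

/-- `(d/dx)^I = (d/dx^1)^{i_1} ⋯ (d/dx^N)^{i_N}`. -/
def totalDerivPow {N : ℕ} (I : MultiIndex N) : Module.End ℝ (Loc N) :=
  (List.ofFn fun i => totalDeriv i ^ I i).prod

theorem vertDeriv_pairwise {N : ℕ} (α : MultiIndex N →₀ ℕ) :
    (α.support : Set (MultiIndex N)).Pairwise
      (Function.onFun Commute fun J => (pderiv (Sum.inr J) ^ α J : Module.End ℝ (Loc N))) :=
  fun _ _ _ _ _ => (pderiv_commute _ _).pow_pow _ _

/-- `(∂/∂u)^α = ∏_J ∂^{α(J)}/∂u_J^{α(J)}`, where `α` has finite support. -/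
def vertDerivPow {N : ℕ} (α : MultiIndex N →₀ ℕ) : Module.End ℝ (Loc N) :=
  α.support.noncommProd (fun J => pderiv (Sum.inr J) ^ α J) (vertDeriv_pairwise α)

/-- The formal differential degree of `α`: the maximal order of a `J` with `α(J) ≠ 0`
(and `0` for `α = 0`). -/
def formalDegree {N : ℕ} (α : MultiIndex N →₀ ℕ) : ℕ := α.support.sup MultiIndex.order

theorem exists_vertDerivPow_eq_zero {N : ℕ} (f : Loc N) :
    ∃ n, ∀ α : MultiIndex N →₀ ℕ, n < formalDegree α → vertDerivPow α f = 0 := by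
  obtain ⟨S, hS⟩ := exists_finset_pderiv f
  refine ⟨S.sup (Sum.elim (fun _ => 0) MultiIndex.order), fun α hα => ?_⟩
  obtain ⟨J, hJ, hlt⟩ := (Finset.lt_sup_iff).1 hα
  have hJS : (Sum.inr J : JetCoord N) ∉ S := fun h =>
    absurd (Finset.le_sup (f := Sum.elim (fun _ => 0) MultiIndex.order) h) (not_le.2 hlt)
  rw [vertDerivPow, ← Finset.noncommProd_erase_mul _ hJ]
  obtain ⟨m, hm⟩ := Nat.exists_eq_succ_of_ne_zero (Finsupp.mem_support_iff.1 hJ)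
  rw [hm, pow_succ]
  simp [Module.End.mul_apply, hS _ hJS]

/-- The coefficients `p_{I,α}` of a formal expression `∑ p_{I,α} (d/dx)^I (∂/∂u)^α` such that for
each `n` only finitely many `p_{I,α}` with `deg_f α ≤ n` are nonzero (a total symbol). -/
structure LDOSymbol (N : ℕ) where
  coeff : MultiIndex N → (MultiIndex N →₀ ℕ) → Loc N
  finite_coeff : ∀ n : ℕ, {c : MultiIndex N × (MultiIndex N →₀ ℕ) |
    coeff c.1 c.2 ≠ 0 ∧ formalDegree c.2 ≤ n}.Finite

theorem LDOSymbol.finite_support {N : ℕ} (σ : LDOSymbol N) (f : Loc N) :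
    (Function.support fun c : MultiIndex N × (MultiIndex N →₀ ℕ) =>
      σ.coeff c.1 c.2 * totalDerivPow c.1 (vertDerivPow c.2 f)).Finite := by
  obtain ⟨n, hn⟩ := exists_vertDerivPow_eq_zero f
  refine (σ.finite_coeff n).subset fun c hc => ⟨fun h => hc (by simp [h]), ?_⟩
  by_contra h
  exact hc (by simp [hn _ (not_le.1 h)])

/-- The operator `f ↦ ∑ p_{I,α} (d/dx)^I (∂/∂u)^α f` (a finite sum for each `f`). -/
def LDOSymbol.toEnd {N : ℕ} (σ : LDOSymbol N) : Module.End ℝ (Loc N) where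
  toFun f := ∑ᶠ c : MultiIndex N × (MultiIndex N →₀ ℕ),
    σ.coeff c.1 c.2 * totalDerivPow c.1 (vertDerivPow c.2 f)
  map_add' f g := by
    simp only [map_add, mul_add]
    exact finsum_add_distrib (σ.finite_support f) (σ.finite_support g)
  map_smul' r f := by
    simp only [map_smul, mul_smul_comm, RingHom.id_apply]
    rw [smul_finsum' r (σ.finite_support f)]

/-- A linear map `A : Loc(E) → Loc(E)` is a local differential operator (LDO). -/
def IsLDO {N : ℕ} (A : Module.End ℝ (Loc N)) : Prop := ∃ σ : LDOSymbol N, A = σ.toEnd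

/-- The characteristic on coefficients: `∑_I (-1)^{|I|} (d/dx)^I p_{I,α}` is the new coefficient
of `(∂/∂u)^α`, and no total derivatives remain. -/
def LDOSymbol.char {N : ℕ} (σ : LDOSymbol N) : LDOSymbol N where
  coeff I α := if I = 0 then
    ∑ᶠ K : MultiIndex N, (-1 : ℝ) ^ K.order • totalDerivPow K (σ.coeff K α) else 0
  finite_coeff n := by
    refine ((σ.finite_coeff n).image fun c => ((0 : MultiIndex N), c.2)).subset ?_
    rintro ⟨I, α⟩ ⟨h, hα⟩
    by_cases hI : I = 0
    · subst hI
      obtain ⟨K, hK⟩ : ∃ K : MultiIndex N,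
          (-1 : ℝ) ^ K.order • totalDerivPow K (σ.coeff K α) ≠ 0 := by
        by_contra! h0
        exact h (by simpa using finsum_eq_zero_of_forall_eq_zero h0)
      exact ⟨(K, α), ⟨fun h0 => hK (by simp [show σ.coeff K α = 0 from h0]), hα⟩, rfl⟩
    · simp [hI] at h

open Classical in
/-- The characteristic `χ(A) = ∑_{I,α} (-1)^{|I|} ((d/dx)^I p_{I,α}) (∂/∂u)^α` of the LDO
`A = ∑_{I,α} p_{I,α} (d/dx)^I (∂/∂u)^α`. The coefficients `p_{I,α}` are determined by `A`, so
nothing depends on their choice; the value `0` at maps which are not LDOs is a convention. -/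
def chi {N : ℕ} (A : Module.End ℝ (Loc N)) : Module.End ℝ (Loc N) :=
  if h : IsLDO A then h.choose.char.toEnd else 0

/-- The horizontal forms of degree `k`, i.e. of bidegree `(k, 0)`: `ω` is the form
`∑_S ω_S dx^S`, where `S` runs over the subsets of `{1, …, N}` with `k` elements and `dx^S` is the
wedge product of the `dx^i`, `i ∈ S`, in increasing order. -/
abbrev HForm (N k : ℕ) : Type := {S : Finset (Fin N) // S.card = k} → Loc N

/-- The horizontal differential `d_H ω = ∑_i dx^i ∧ (d/dx^i) ω`. As
`dx^i ∧ dx^S = (-1)^{#{j ∈ S, j < i}} dx^{S ∪ {i}}` if `i ∉ S`, and `0` otherwise, the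
coefficient of `dx^T` is a signed sum over the `i ∈ T` with `S = T \ {i}`. -/
def dH {N k : ℕ} : HForm N k →ₗ[ℝ] HForm N (k + 1) :=
  LinearMap.pi fun T => ∑ i : {i // i ∈ T.1},
    (-1 : ℝ) ^ (T.1.filter (fun j => j < i.1)).card •
      (totalDeriv i.1 ∘ₗ LinearMap.proj (R := ℝ)
        (⟨T.1.erase i.1, by rw [Finset.card_erase_of_mem i.2, T.2, Nat.add_sub_cancel]⟩ :
          {S : Finset (Fin N) // S.card = k}))

/-- The matrix element `f ↦ (A (f dx^S))_T` of a linear map between spaces of forms. -/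
def matrixEntry {N k l : ℕ} (A : HForm N k →ₗ[ℝ] HForm N l)
    (S : {S : Finset (Fin N) // S.card = k}) (T : {T : Finset (Fin N) // T.card = l}) :
    Module.End ℝ (Loc N) :=
  LinearMap.proj (R := ℝ) T ∘ₗ A ∘ₗ LinearMap.single ℝ (fun _ => Loc N) S

/-- A linear map between spaces of forms is an LDO if its matrix elements are. -/
def IsFormLDO {N k l : ℕ} (A : HForm N k →ₗ[ℝ] HForm N l) : Prop :=
  ∀ S T, IsLDO (matrixEntry A S T)

/-- The operator on `Loc(E)` which corresponds to an operator on top degree forms under the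
identification `f ↦ f dx^1 ∧ ⋯ ∧ dx^N`. -/
def topOp {N : ℕ} (A : HForm N N →ₗ[ℝ] HForm N N) : Module.End ℝ (Loc N) :=
  matrixEntry A ⟨Finset.univ, by simp⟩ ⟨Finset.univ, by simp⟩

/-- The operator on forms which acts diagonally, `f dx^S ↦ B(f) dx^S`. -/
def diagOp {N k : ℕ} (B : Module.End ℝ (Loc N)) : HForm N k →ₗ[ℝ] HForm N k :=
  LinearMap.pi fun S => B ∘ₗ LinearMap.proj (R := ℝ) S

/-- `A_0, …, A_N` is a lift of the operator `A` on top degree forms: a sequence of LDOs which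
commutes with `d_H` and ends in `A_N = A`. (Only the `A_s` with `s ≤ N` matter, as there are no
nonzero forms of degree `s > N`.) -/
structure IsLift {N : ℕ} (A : HForm N N →ₗ[ℝ] HForm N N)
    (L : ∀ s : ℕ, HForm N s →ₗ[ℝ] HForm N s) : Prop where
  top : L N = A
  isLDO : ∀ s ≤ N, IsFormLDO (L s)
  comm : ∀ s < N, dH ∘ₗ L s = L (s + 1) ∘ₗ dH

end

end VarBicomplex

/-! The characteristic kills total divergences `totalDeriv i ∘ₗ B` (`chi_totalDeriv_comp`). If `A`
has a lift, then `A ∘ₗ dH = dH ∘ₗ L (N - 1)` for `N ≥ 1`. The matrix entries of the right side are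
signed sums of divergences, those of the left side are `±A ∘ d/dx^i`, and necessity follows.

For sufficiency, write D_i for d/dx^i. Integration by parts gives `A` = Q + ∑ D_i B_i with Q =
χ(`A`) (`exists_eq_chi_add_divergence`). As Q contains no total derivatives, neither does its
commutator with D_i, and this yields χ(`A` D_i) = Q D_i - D_i Q (`chi_comp_totalDeriv`). The
hypothesis therefore says that Q commutes with every D_i, so the diagonal action of Q commutes with
`dH`. Let H be contraction with the B_i on N-forms and zero on all other forms. Then Q + `dH` H + H
`dH` commutes with `dH` because `dH` squares to zero. In degree N it is Q + ∑ D_i B_i = `A`, and in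
degrees at most N - 2 it is Q (`homotopyLift`).

All this needs χ to be independent of the chosen coefficients. `toEnd_injective` provides that: test
functions, monomials centred at a point of the jet space, isolate one coefficient at a time. -/

namespace VarBicomplex

noncomputable section

/-! ### Leibniz rules and commutation relations of partial and total derivatives. -/

section Derivations

variable {N : ℕ}

theorem pderiv_mul (c : JetCoord N) (f g : Loc N) :
    pderiv c (f * g) = pderiv c f * g + f * pderiv c g := by
  ext p
  have h := (f.2.differentiableAt c p).hasDerivAt.mul (g.2.differentiableAt c p).hasDerivAt
  simp only [Function.update_eq_self] at h
  exact h.deriv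

theorem pderiv_coord (c d : JetCoord N) : pderiv c (coord d) = if c = d then 1 else 0 := by
  ext p
  change deriv (fun t => Function.update p c t d) (p c) = _
  split_ifs with h
  · subst h
    simp
  · simp [Function.update_of_ne (Ne.symm h)]

theorem pderiv_apply_comm (c d : JetCoord N) (f : Loc N) :
    pderiv c (pderiv d f) = pderiv d (pderiv c f) :=
  LinearMap.congr_fun (pderiv_commute c d).eq f

theorem exists_finset_vert (f : Loc N) :
    ∃ S : Finset (MultiIndex N), ∀ J ∉ S, pderiv (Sum.inr J) f = 0 := by
  classical
  obtain ⟨S, hS⟩ := exists_finset_pderiv f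
  exact ⟨S.preimage Sum.inr Sum.inr_injective.injOn, fun J hJ => hS _ (by simpa using hJ)⟩

/-- The freedom in `S` lets several functions be differentiated over one common index set. -/
theorem totalDeriv_eq_sum (i : Fin N) (f : Loc N) {S : Finset (MultiIndex N)}
    (hS : ∀ J ∉ S, pderiv (Sum.inr J) f = 0) :
    totalDeriv i f = pderiv (Sum.inl i) f +
      ∑ J ∈ S, coord (Sum.inr (J.shift i)) * pderiv (Sum.inr J) f := by
  refine congrArg (pderiv (Sum.inl i) f + ·) ?_
  refine finsum_eq_sum_of_support_subset _ fun J hJ => ?_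
  by_contra h
  exact hJ (by simp [hS J h])

theorem totalDeriv_mul (i : Fin N) (f g : Loc N) :
    totalDeriv i (f * g) = totalDeriv i f * g + f * totalDeriv i g := by
  classical
  obtain ⟨S, hS⟩ := exists_finset_vert f
  obtain ⟨T, hT⟩ := exists_finset_vert g
  have hS' : ∀ J ∉ S ∪ T, pderiv (Sum.inr J) f = 0 := fun J hJ => hS J (by simp_all)
  have hT' : ∀ J ∉ S ∪ T, pderiv (Sum.inr J) g = 0 := fun J hJ => hT J (by simp_all)
  rw [totalDeriv_eq_sum i f hS', totalDeriv_eq_sum i g hT', totalDeriv_eq_sum i (f * g)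
    (S := S ∪ T) (fun J hJ => by rw [pderiv_mul, hS' J hJ, hT' J hJ]; simp)]
  simp only [pderiv_mul, add_mul, mul_add, Finset.sum_mul, Finset.mul_sum,
    Finset.sum_add_distrib]
  have h1 : ∀ J : MultiIndex N, coord (Sum.inr (J.shift i)) * (f * pderiv (Sum.inr J) g) =
      f * (coord (Sum.inr (J.shift i)) * pderiv (Sum.inr J) g) := fun J => by ring
  have h2 : ∀ J : MultiIndex N, coord (Sum.inr (J.shift i)) * (pderiv (Sum.inr J) f * g) =
      coord (Sum.inr (J.shift i)) * pderiv (Sum.inr J) f * g := fun J => by ring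
  simp only [h1, h2]
  abel

theorem totalDeriv_coord_inl (i j : Fin N) :
    totalDeriv i (coord (Sum.inl j)) = if i = j then 1 else 0 := by
  rw [totalDeriv_eq_sum i _ (S := ∅) (by simp [pderiv_coord])]
  simp [pderiv_coord]

theorem totalDeriv_coord_inr (i : Fin N) (J : MultiIndex N) :
    totalDeriv i (coord (Sum.inr J)) = coord (Sum.inr (J.shift i)) := by
  rw [totalDeriv_eq_sum i _ (S := {J}) (by simp +contextual [pderiv_coord])]
  simp [pderiv_coord]

theorem MultiIndex.shift_comm (i j : Fin N) (J : MultiIndex N) :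
    (J.shift i).shift j = (J.shift j).shift i := by
  simp [MultiIndex.shift, add_right_comm]

theorem MultiIndex.shift_injective (i : Fin N) :
    Function.Injective (MultiIndex.shift i : MultiIndex N → MultiIndex N) :=
  add_left_injective _

theorem MultiIndex.order_shift (i : Fin N) (J : MultiIndex N) :
    (J.shift i).order = J.order + 1 := by
  simp [MultiIndex.order, MultiIndex.shift, Finset.sum_add_distrib]

/-- The multi-index `J` with its `i`-th entry decreased by `1` (if it is positive). -/
def MultiIndex.unshift (i : Fin N) (J : MultiIndex N) : MultiIndex N := J - Pi.single i 1

theorem MultiIndex.unshift_shift (i : Fin N) (J : MultiIndex N) :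
    (J.shift i).unshift i = J := by
  simp [MultiIndex.shift, MultiIndex.unshift]

theorem MultiIndex.shift_unshift {i : Fin N} {J : MultiIndex N} (h : J i ≠ 0) :
    (J.unshift i).shift i = J := by
  funext j
  by_cases hj : j = i
  · subst hj
    simp [MultiIndex.shift, MultiIndex.unshift]
    omega
  · simp [MultiIndex.shift, MultiIndex.unshift, hj]

theorem MultiIndex.shift_apply_self (i : Fin N) (J : MultiIndex N) : J.shift i i = J i + 1 := by
  simp [MultiIndex.shift]

theorem MultiIndex.shift_apply_of_ne {i j : Fin N} (h : i ≠ j) (J : MultiIndex N) :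
    J.shift i j = J j := by
  simp [MultiIndex.shift, h.symm]

theorem MultiIndex.order_unshift {i : Fin N} {J : MultiIndex N} (h : J i ≠ 0) :
    J.order = (J.unshift i).order + 1 := by
  rw [← MultiIndex.order_shift i, MultiIndex.shift_unshift h]

@[elab_as_elim]
theorem MultiIndex.induction_shift {motive : MultiIndex N → Prop} (zero : motive 0)
    (shift : ∀ i J, motive J → motive (MultiIndex.shift i J)) (J : MultiIndex N) : motive J := by
  induction h : J.order generalizing J with
  | zero =>
    have : J = 0 := by
      funext i
      simpa using (Finset.sum_eq_zero_iff.1 h) i (Finset.mem_univ i)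
    rwa [this]
  | succ n ih =>
    obtain ⟨i, -, hi⟩ : ∃ i ∈ Finset.univ, J i ≠ 0 := by
      apply Finset.exists_ne_zero_of_sum_ne_zero
      change J.order ≠ 0
      omega
    rw [← MultiIndex.shift_unshift hi]
    exact shift i _ (ih _ (by have := MultiIndex.order_unshift hi; omega))

/-- The commutator of `∂/∂u_J` with `d/dx^i`. -/
def vertLower (i : Fin N) (J : MultiIndex N) : Module.End ℝ (Loc N) :=
  if J i = 0 then 0 else pderiv (Sum.inr (J.unshift i))

theorem vertLower_shift (i : Fin N) (J : MultiIndex N) :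
    vertLower i (J.shift i) = pderiv (Sum.inr J) := by
  simp [vertLower, MultiIndex.unshift_shift, MultiIndex.shift_apply_self]

theorem pderiv_totalDeriv_inl (i j : Fin N) (f : Loc N) :
    pderiv (Sum.inl j) (totalDeriv i f) = totalDeriv i (pderiv (Sum.inl j) f) := by
  obtain ⟨S, hS⟩ := exists_finset_vert f
  have hS' : ∀ J ∉ S, pderiv (Sum.inr J) (pderiv (Sum.inl j) f) = 0 := fun J hJ => by
    rw [pderiv_apply_comm, hS J hJ, map_zero]
  rw [totalDeriv_eq_sum i f hS, totalDeriv_eq_sum i _ hS']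
  simp [map_sum, pderiv_mul, pderiv_coord, pderiv_apply_comm (Sum.inl j)]

/-- The extra term comes from the coefficients `u_{iJ}`: at most one of them is `u_K`, namely that
with `K = iJ`. -/
theorem pderiv_totalDeriv_inr (i : Fin N) (K : MultiIndex N) (f : Loc N) :
    pderiv (Sum.inr K) (totalDeriv i f) =
      totalDeriv i (pderiv (Sum.inr K) f) + vertLower i K f := by
  classical
  obtain ⟨S, hS⟩ := exists_finset_vert f
  have hS' : ∀ J ∉ S, pderiv (Sum.inr J) (pderiv (Sum.inr K) f) = 0 := fun J hJ => by
    rw [pderiv_apply_comm, hS J hJ, map_zero]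
  rw [totalDeriv_eq_sum i f hS, totalDeriv_eq_sum i _ hS']
  simp only [map_add, map_sum, pderiv_mul, pderiv_coord, pderiv_apply_comm (Sum.inr K),
    Finset.sum_add_distrib, Sum.inr.injEq]
  have : ∑ J ∈ S, (if K = J.shift i then 1 else 0) * pderiv (Sum.inr J) f = vertLower i K f := by
    by_cases hK : K i = 0
    · rw [vertLower, if_pos hK]
      refine Finset.sum_eq_zero fun J _ => ?_
      rw [if_neg, zero_mul]
      rintro rfl
      simp [MultiIndex.shift_apply_self] at hK
    · obtain ⟨J, rfl⟩ : ∃ J : MultiIndex N, K = J.shift i := ⟨_, (MultiIndex.shift_unshift hK).symm⟩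
      rw [vertLower_shift]
      simp only [(MultiIndex.shift_injective i).eq_iff, ite_mul, one_mul, zero_mul,
        Finset.sum_ite_eq]
      split_ifs with h
      · rfl
      · exact (hS J h).symm
  rw [this]
  abel

/-- After expansion the second-order terms agree. What remains is `∑ u_{ijJ} ∂f/∂u_J` on one side
and `∑ u_{jJ} [∂/∂u_J, d/dx^i] f` on the other; reindexing by `J ↦ iJ` identifies them. -/
theorem totalDeriv_apply_comm (i j : Fin N) (f : Loc N) :
    totalDeriv i (totalDeriv j f) = totalDeriv j (totalDeriv i f) := by
  classical
  obtain ⟨S, hS⟩ := exists_finset_vert f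
  obtain ⟨T, hT⟩ := exists_finset_vert (totalDeriv i f)
  -- The image of `S` is included so that the reindexed sum still runs inside `U`.
  set U := S ∪ T ∪ S.image (MultiIndex.shift i)
  have hU : ∀ J ∉ U, pderiv (Sum.inr J) f = 0 := fun J hJ => hS J (by simp_all [U])
  have hU' : ∀ J ∉ U, pderiv (Sum.inr J) (totalDeriv i f) = 0 := fun J hJ => hT J (by simp_all [U])
  rw [totalDeriv_eq_sum j f hU, totalDeriv_eq_sum j _ hU', map_add, map_sum,
    pderiv_totalDeriv_inl]
  simp only [totalDeriv_mul, pderiv_totalDeriv_inr, totalDeriv_coord_inr, mul_add,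
    Finset.sum_add_distrib]
  have : ∑ J ∈ U, coord (Sum.inr ((J.shift j).shift i)) * pderiv (Sum.inr J) f =
      ∑ J ∈ U, coord (Sum.inr (J.shift j)) * vertLower i J f := by
    calc _ = ∑ J ∈ S, coord (Sum.inr ((J.shift j).shift i)) * pderiv (Sum.inr J) f :=
          (Finset.sum_subset (by intro J hJ; simp [U, hJ])
            (fun J _ hJ => by rw [hS J hJ, mul_zero])).symm
      _ = ∑ J ∈ S.image (MultiIndex.shift i), coord (Sum.inr (J.shift j)) * vertLower i J f := by
          rw [Finset.sum_image (MultiIndex.shift_injective i).injOn]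
          simp only [vertLower_shift, MultiIndex.shift_comm i j]
      _ = _ := by
          refine Finset.sum_subset (fun J hJ => Finset.mem_union_right _ hJ) fun J _ hJ => ?_
          by_cases h : J i = 0
          · simp [vertLower, h]
          · have : J.unshift i ∉ S := fun h' =>
              hJ (Finset.mem_image.2 ⟨_, h', MultiIndex.shift_unshift h⟩)
            rw [vertLower, if_neg h, hS _ this, mul_zero]
  rw [this]
  abel

theorem totalDeriv_commute (i j : Fin N) :
    Commute (totalDeriv i : Module.End ℝ (Loc N)) (totalDeriv j) :=
  LinearMap.ext (totalDeriv_apply_comm i j)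

theorem prod_ofFn_pow_add_single {M : Type*} [Monoid M] {n : ℕ} (a : Fin n → M)
    (h : ∀ i j, Commute (a i) (a j)) (I : Fin n → ℕ) (i : Fin n) :
    (List.ofFn fun j => a j ^ (I + Pi.single i 1 : Fin n → ℕ) j).prod =
      a i * (List.ofFn fun j => a j ^ I j).prod := by
  induction n with
  | zero => exact i.elim0
  | succ n ih =>
    rw [List.ofFn_succ, List.ofFn_succ, List.prod_cons, List.prod_cons]
    refine Fin.cases ?_ (fun k => ?_) i
    · simp [pow_succ', mul_assoc]
    · have := ih (fun j => a j.succ) (fun _ _ => h _ _) (fun j => I j.succ) k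
      have e : ∀ j : Fin n, (I + Pi.single k.succ 1 : Fin (n + 1) → ℕ) j.succ =
          ((fun j : Fin n => I j.succ) + Pi.single k 1 : Fin n → ℕ) j := by
        intro j
        simp [Pi.single_apply]
      simp only [e, this]
      rw [← mul_assoc, ← mul_assoc]
      simp [((h 0 k.succ).pow_left (I 0)).eq]

theorem totalDerivPow_zero : totalDerivPow (0 : MultiIndex N) = 1 := by
  simp [totalDerivPow]

theorem totalDerivPow_shift (i : Fin N) (I : MultiIndex N) :
    totalDerivPow (I.shift i) = totalDeriv i * totalDerivPow I :=
  prod_ofFn_pow_add_single _ totalDeriv_commute I i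

theorem totalDerivPow_shift_apply (i : Fin N) (I : MultiIndex N) (f : Loc N) :
    totalDerivPow (I.shift i) f = totalDeriv i (totalDerivPow I f) := by
  rw [totalDerivPow_shift]; rfl

theorem totalDerivPow_commute (i : Fin N) (I : MultiIndex N) :
    Commute (totalDerivPow I) (totalDeriv i) := by
  induction I using MultiIndex.induction_shift with
  | zero => rw [totalDerivPow_zero]; exact Commute.one_left _
  | shift j I ih => rw [totalDerivPow_shift]; exact (totalDeriv_commute j i).mul_left ih

theorem totalDerivPow_totalDeriv (i : Fin N) (I : MultiIndex N) (f : Loc N) :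
    totalDerivPow I (totalDeriv i f) = totalDeriv i (totalDerivPow I f) :=
  LinearMap.congr_fun (totalDerivPow_commute i I).eq f

theorem vertDerivPow_zero : vertDerivPow (0 : MultiIndex N →₀ ℕ) = 1 := by
  exact Finset.noncommProd_empty _ _

theorem vertDeriv_pairwise_finset (α : MultiIndex N →₀ ℕ) (S : Finset (MultiIndex N)) :
    (S : Set (MultiIndex N)).Pairwise
      (Function.onFun Commute fun J => (pderiv (Sum.inr J) ^ α J : Module.End ℝ (Loc N))) :=
  fun _ _ _ _ _ => (pderiv_commute _ _).pow_pow _ _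

theorem vertDerivPow_eq_noncommProd (α : MultiIndex N →₀ ℕ) {S : Finset (MultiIndex N)}
    (h : α.support ⊆ S) :
    vertDerivPow α = S.noncommProd (fun J => pderiv (Sum.inr J) ^ α J) (vertDeriv_pairwise_finset α S) := by
  classical
  have e : S = α.support ∪ S \ α.support := (Finset.union_sdiff_of_subset h).symm
  have h1 : (S \ α.support).noncommProd (fun J => (pderiv (Sum.inr J) : Module.End ℝ (Loc N)) ^ α J)
      (vertDeriv_pairwise_finset α _) = 1 := by
    rw [Finset.noncommProd_eq_pow_card _ _ _ 1, one_pow]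
    intro J hJ
    have : α J = 0 := by simpa using (Finset.mem_sdiff.1 hJ).2
    rw [this, pow_zero]
  symm
  refine (Finset.noncommProd_congr e (fun _ _ => rfl) _).trans ?_
  refine (Finset.noncommProd_union_of_disjoint Finset.disjoint_sdiff _
    (vertDeriv_pairwise_finset α _)).trans ?_
  rw [h1, mul_one]
  rfl

theorem vertDerivPow_add_single (α : MultiIndex N →₀ ℕ) (J : MultiIndex N) :
    vertDerivPow (α + Finsupp.single J 1) = pderiv (Sum.inr J) * vertDerivPow α := by
  classical
  -- Over this common index set the two products differ only in the factor at `J`, whether or not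
  -- `J` lies in the support of `α`.
  have h1 : α.support ⊆ insert J (α.support.erase J) := Finset.insert_erase_subset _ _
  have h2 : (α + Finsupp.single J 1).support ⊆ insert J (α.support.erase J) := by
    intro K hK
    by_cases h : K = J
    · simp [h]
    · have : ¬ J = K := fun e => h e.symm
      simpa [h, this] using hK
  rw [vertDerivPow_eq_noncommProd _ h1, vertDerivPow_eq_noncommProd _ h2,
    Finset.noncommProd_insert_of_notMem _ _ _ _ (Finset.notMem_erase _ _),
    Finset.noncommProd_insert_of_notMem _ _ _ _ (Finset.notMem_erase _ _), ← mul_assoc]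
  refine congrArg₂ (α := Module.End ℝ (Loc N)) (· * ·) ?_ ?_
  · simp [pow_succ']
  · refine Finset.noncommProd_congr rfl (fun K hK => ?_) _
    have : ¬ J = K := fun e => (Finset.mem_erase.1 hK).1 e.symm
    simp [this]

theorem vertDerivPow_add_single_apply (α : MultiIndex N →₀ ℕ) (J : MultiIndex N) (f : Loc N) :
    vertDerivPow (α + Finsupp.single J 1) f = pderiv (Sum.inr J) (vertDerivPow α f) := by
  rw [vertDerivPow_add_single]; rfl

@[elab_as_elim]
theorem finsupp_induction_add_single {ι : Type*} {motive : (ι →₀ ℕ) → Prop} (zero : motive 0)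
    (add_single : ∀ J α, motive α → motive (α + Finsupp.single J 1)) (α : ι →₀ ℕ) : motive α := by
  have key : ∀ (J : ι) (n : ℕ) α, motive α → motive (α + Finsupp.single J n) := by
    intro J n
    induction n with
    | zero => intro α h; simpa using h
    | succ n ih =>
      intro α h
      rw [Finsupp.single_add, ← add_assoc]
      exact add_single J _ (ih α h)
  induction α using Finsupp.induction with
  | zero => exact zero
  | single_add J n α _ _ ih => rw [add_comm]; exact key J n α ih

end Derivations

/-! ### Locally finite sums of symbols and their decomposition into monomials. -/

namespace LDOSymbol

variable {N : ℕ} {ι : Type*}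

@[ext]
theorem ext {σ τ : LDOSymbol N} (h : ∀ I α, σ.coeff I α = τ.coeff I α) : σ = τ := by
  cases σ
  cases τ
  congr
  funext I α
  exact h I α

theorem toEnd_apply (σ : LDOSymbol N) (f : Loc N) :
    σ.toEnd f = ∑ᶠ c : MultiIndex N × (MultiIndex N →₀ ℕ),
      σ.coeff c.1 c.2 * totalDerivPow c.1 (vertDerivPow c.2 f) := rfl

theorem char_coeff (σ : LDOSymbol N) (I : MultiIndex N) (α : MultiIndex N →₀ ℕ) :
    σ.char.coeff I α = if I = 0 then
      ∑ᶠ K : MultiIndex N, (-1 : ℝ) ^ K.order • totalDerivPow K (σ.coeff K α) else 0 := rfl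

theorem finite_coeff_fst (σ : LDOSymbol N) (α : MultiIndex N →₀ ℕ) :
    {K | σ.coeff K α ≠ 0}.Finite :=
  ((σ.finite_coeff (formalDegree α)).preimage
    (f := fun K => (K, α)) (fun _ _ _ _ h => (Prod.ext_iff.1 h).1)).subset
    fun _ hK => ⟨hK, le_rfl⟩

theorem finite_support_char (σ : LDOSymbol N) (α : MultiIndex N →₀ ℕ) :
    (Function.support fun K : MultiIndex N =>
      (-1 : ℝ) ^ K.order • totalDerivPow K (σ.coeff K α)).Finite :=
  (σ.finite_coeff_fst α).subset fun K hK h => hK (by simp [h])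

/-- A family of symbols of which only finitely many have a coefficient in formal degrees `≤ n`,
for each `n`. -/
def LocallyFinite (τ : ι → LDOSymbol N) : Prop :=
  ∀ n, {i | ∃ I α, (τ i).coeff I α ≠ 0 ∧ formalDegree α ≤ n}.Finite

theorem LocallyFinite.of_finite [Finite ι] (τ : ι → LDOSymbol N) : LocallyFinite τ :=
  fun _ => Set.toFinite _

theorem LocallyFinite.char {τ : ι → LDOSymbol N} (h : LocallyFinite τ) :
    LocallyFinite fun i => (τ i).char := by
  refine fun n => (h n).subset ?_
  rintro i ⟨I, α, hc, hα⟩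
  by_contra h0
  have : ∀ K, (τ i).coeff K α = 0 := fun K => by
    by_contra hK
    exact h0 ⟨K, α, hK, hα⟩
  simp [char_coeff, this] at hc

/-- The sum of a locally finite family of symbols. -/
def sum (τ : ι → LDOSymbol N) (h : LocallyFinite τ) : LDOSymbol N where
  coeff I α := ∑ᶠ i, (τ i).coeff I α
  finite_coeff n := by
    refine ((h n).biUnion fun i _ => (τ i).finite_coeff n).subset ?_
    rintro ⟨I, α⟩ ⟨hc, hα⟩
    obtain ⟨i, hi⟩ : ∃ i, (τ i).coeff I α ≠ 0 := by
      by_contra! h0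
      exact hc (finsum_eq_zero_of_forall_eq_zero h0)
    exact Set.mem_biUnion (x := i) ⟨I, α, hi, hα⟩ ⟨hi, hα⟩

theorem sum_coeff (τ : ι → LDOSymbol N) (h : LocallyFinite τ) (I : MultiIndex N)
    (α : MultiIndex N →₀ ℕ) : (sum τ h).coeff I α = ∑ᶠ i, (τ i).coeff I α := rfl

theorem LocallyFinite.sum_coeff_eq {τ : ι → LDOSymbol N} (h : LocallyFinite τ) {n : ℕ}
    (I : MultiIndex N) {α : MultiIndex N →₀ ℕ} (hα : formalDegree α ≤ n) :
    (sum τ h).coeff I α = ∑ i ∈ (h n).toFinset, (τ i).coeff I α :=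
  finsum_eq_sum_of_support_subset _ fun i hi => by
    simpa using ⟨I, α, hi, hα⟩

theorem LocallyFinite.toEnd_apply_eq_zero {τ : ι → LDOSymbol N} (h : LocallyFinite τ) {n : ℕ}
    {f : Loc N} (hn : ∀ α : MultiIndex N →₀ ℕ, n < formalDegree α → vertDerivPow α f = 0)
    {i : ι} (hi : i ∉ (h n).toFinset) : (τ i).toEnd f = 0 := by
  rw [toEnd_apply]
  refine finsum_eq_zero_of_forall_eq_zero fun c => ?_
  by_cases hc : formalDegree c.2 ≤ n
  · have : (τ i).coeff c.1 c.2 = 0 := by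
      by_contra h0
      exact hi (by simpa using ⟨c.1, c.2, h0, hc⟩)
    rw [this, zero_mul]
  · rw [hn _ (not_le.1 hc), map_zero, mul_zero]

theorem LocallyFinite.finite_support_toEnd {τ : ι → LDOSymbol N} (h : LocallyFinite τ)
    (f : Loc N) : (Function.support fun i => (τ i).toEnd f).Finite := by
  obtain ⟨n, hn⟩ := exists_vertDerivPow_eq_zero f
  refine (h n).subset fun i hi => ?_
  by_contra hi'
  exact hi (h.toEnd_apply_eq_zero hn (by simpa using hi'))

/-- A fixed `f` is killed by all vertical derivatives of large formal degree, so only finitely many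
members of the family act on it and the sums may be exchanged. -/
theorem toEnd_sum_apply (τ : ι → LDOSymbol N) (h : LocallyFinite τ) (f : Loc N) :
    (sum τ h).toEnd f = ∑ᶠ i, (τ i).toEnd f := by
  obtain ⟨n, hn⟩ := exists_vertDerivPow_eq_zero f
  rw [finsum_eq_sum_of_support_subset (s := (h n).toFinset) _ fun i hi => by
    by_contra hi'
    exact hi (h.toEnd_apply_eq_zero hn hi')]
  simp only [toEnd_apply]
  rw [← finsum_sum_comm _ _ fun i _ => (τ i).finite_support f]
  refine finsum_congr fun c => ?_
  by_cases hc : formalDegree c.2 ≤ n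
  · rw [h.sum_coeff_eq _ hc, Finset.sum_mul]
  · simp [hn _ (not_le.1 hc)]

/-- Additivity over infinite families reduces computations of characteristics to monomials `single I
α p`. -/
theorem char_sum (τ : ι → LDOSymbol N) (h : LocallyFinite τ) :
    (sum τ h).char = sum (fun i => (τ i).char) h.char := by
  ext1 I α
  have hs : ∀ i ∉ (h (formalDegree α)).toFinset, ∀ K, (τ i).coeff K α = 0 := by
    intro i hi K
    by_contra h0
    exact hi (by simpa using ⟨K, α, h0, le_rfl⟩)
  rw [sum_coeff, finsum_eq_sum_of_support_subset (s := (h (formalDegree α)).toFinset) _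
    fun i hi => by
      by_contra hi'
      exact hi (by simp [char_coeff, hs i hi'])]
  simp only [char_coeff]
  split_ifs with hI
  · rw [← finsum_sum_comm _ _ fun i _ => (τ i).finite_support_char α]
    refine finsum_congr fun K => ?_
    rw [h.sum_coeff_eq K le_rfl, map_sum, Finset.smul_sum]
  · simp

/-- The symbol of `p (d/dx)^I (∂/∂u)^α`. -/
def single (I : MultiIndex N) (α : MultiIndex N →₀ ℕ) (p : Loc N) : LDOSymbol N where
  coeff I' α' := if (I', α') = (I, α) then p else 0
  finite_coeff n := (Set.finite_singleton (I, α)).subset fun c hc => by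
    by_contra h
    exact hc.1 (if_neg h)

theorem single_coeff (I I' : MultiIndex N) (α α' : MultiIndex N →₀ ℕ) (p : Loc N) :
    (single I α p).coeff I' α' = if (I', α') = (I, α) then p else 0 := rfl

theorem toEnd_single_apply (I : MultiIndex N) (α : MultiIndex N →₀ ℕ) (p f : Loc N) :
    (single I α p).toEnd f = p * totalDerivPow I (vertDerivPow α f) := by
  rw [toEnd_apply, finsum_eq_single _ (I, α)]
  · simp [single_coeff]
  · rintro ⟨I', α'⟩ h
    rw [single_coeff, if_neg h, zero_mul]

theorem char_single (I : MultiIndex N) (α : MultiIndex N →₀ ℕ) (p : Loc N) :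
    (single I α p).char = single 0 α ((-1 : ℝ) ^ I.order • totalDerivPow I p) := by
  ext1 I' α'
  rw [char_coeff, single_coeff]
  by_cases h : α' = α
  · subst h
    by_cases hI : I' = 0
    · subst hI
      rw [if_pos rfl, if_pos rfl, finsum_eq_single _ I]
      · simp [single_coeff]
      · intro K hK
        simp [single_coeff, hK]
    · simp [hI]
  · simp [single_coeff, h]

/-- This is the criterion for operations performed monomial by monomial on `σ`. The slack `+ 1` is
there because commuting a vertical derivative past a total derivative can lower the formal degree by
one. -/
theorem locallyFinite_of_coeff (σ : LDOSymbol N)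
    {τ : MultiIndex N × (MultiIndex N →₀ ℕ) → LDOSymbol N}
    (h0 : ∀ c, σ.coeff c.1 c.2 = 0 → ∀ I α, (τ c).coeff I α = 0)
    (h1 : ∀ c I α, (τ c).coeff I α ≠ 0 → formalDegree c.2 ≤ formalDegree α + 1) :
    LocallyFinite τ := by
  refine fun n => (σ.finite_coeff (n + 1)).subset ?_
  rintro c ⟨I, α, hc, hα⟩
  refine ⟨fun h => hc (h0 c h I α), (h1 c I α hc).trans (by omega)⟩

theorem locallyFinite_single (σ : LDOSymbol N) :
    LocallyFinite fun c : MultiIndex N × (MultiIndex N →₀ ℕ) =>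
      single c.1 c.2 (σ.coeff c.1 c.2) := by
  refine locallyFinite_of_coeff σ (fun c h I α => by simp [single_coeff, h]) ?_
  intro c I α h
  rw [single_coeff] at h
  obtain ⟨rfl, rfl⟩ := Prod.ext_iff.1 (of_not_not fun h' => h (if_neg h'))
  simp

theorem sum_single (σ : LDOSymbol N) : sum _ σ.locallyFinite_single = σ := by
  ext1 I α
  rw [sum_coeff, finsum_eq_single _ (I, α)]
  · simp [single_coeff]
  · intro c hc
    rw [single_coeff, if_neg (Ne.symm hc)]

theorem toEnd_eq_finsum_single (σ : LDOSymbol N) (f : Loc N) : σ.toEnd f =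
    ∑ᶠ c : MultiIndex N × (MultiIndex N →₀ ℕ), (single c.1 c.2 (σ.coeff c.1 c.2)).toEnd f := by
  conv_lhs => rw [← sum_single σ]
  exact toEnd_sum_apply _ _ f

/-- The symbol of `r • A`, where `r` is a real number. -/
def smul (r : ℝ) (σ : LDOSymbol N) : LDOSymbol N where
  coeff I α := r • σ.coeff I α
  finite_coeff n := (σ.finite_coeff n).subset fun c hc =>
    ⟨fun h => hc.1 (by simp [h]), hc.2⟩

theorem toEnd_smul (r : ℝ) (σ : LDOSymbol N) : (smul r σ).toEnd = r • σ.toEnd := by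
  ext1 f
  rw [LinearMap.smul_apply, toEnd_apply, toEnd_apply, smul_finsum' r (σ.finite_support f)]
  exact finsum_congr fun c => smul_mul_assoc _ _ _

theorem char_smul (r : ℝ) (σ : LDOSymbol N) : (smul r σ).char = smul r σ.char := by
  ext1 I α
  change _ = r • σ.char.coeff I α
  rw [char_coeff, char_coeff]
  split_ifs
  · rw [smul_finsum' r (σ.finite_support_char α)]
    refine finsum_congr fun K => ?_
    change _ • totalDerivPow K (r • σ.coeff K α) = _
    rw [map_smul, smul_comm]
  · simp

theorem toEnd_sum_fintype [Fintype ι] (τ : ι → LDOSymbol N) :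
    (sum τ (.of_finite τ)).toEnd = ∑ i, (τ i).toEnd := by
  ext1 f
  rw [toEnd_sum_apply, finsum_eq_sum_of_fintype, LinearMap.sum_apply]

end LDOSymbol

/-! ### Centred monomials as test functions dual to the derivatives. -/

section TestFunctions

variable {N : ℕ}

theorem pderiv_one (c : JetCoord N) : pderiv c (1 : Loc N) = 0 := by
  simpa using pderiv_mul c (1 : Loc N) 1

theorem totalDeriv_one (i : Fin N) : totalDeriv i (1 : Loc N) = 0 := by
  simpa using totalDeriv_mul i (1 : Loc N) 1

/-- The coordinate function `c`, minus its value at `p`. -/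
def centeredCoord (p : Jet N) (c : JetCoord N) : Loc N := coord c - p c • 1

/-- Evaluation at a point of the jet space. -/
def evalAt (p : Jet N) : Loc N →ₗ[ℝ] ℝ :=
  LinearMap.proj p ∘ₗ (Loc N).val.toLinearMap

theorem evalAt_mul (p : Jet N) (f g : Loc N) : evalAt p (f * g) = evalAt p f * evalAt p g := rfl

theorem evalAt_one (p : Jet N) : evalAt p 1 = 1 := rfl

theorem evalAt_centeredCoord (p : Jet N) (c : JetCoord N) : evalAt p (centeredCoord p c) = 0 := by
  rw [centeredCoord, map_sub, map_smul, evalAt_one, smul_eq_mul, mul_one]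
  exact sub_self _

theorem pderiv_centeredCoord (p : Jet N) (c d : JetCoord N) :
    pderiv c (centeredCoord p d) = if c = d then 1 else 0 := by
  rw [centeredCoord, map_sub, map_smul, pderiv_one, pderiv_coord, smul_zero, sub_zero]

theorem totalDeriv_centeredCoord (p : Jet N) (i j : Fin N) :
    totalDeriv i (centeredCoord p (Sum.inl j)) = if i = j then 1 else 0 := by
  rw [centeredCoord, map_sub, map_smul, totalDeriv_one, totalDeriv_coord_inl, smul_zero, sub_zero]

theorem MultiIndex.shift_unshift_comm {i j : Fin N} (h : j ≠ i) (I : MultiIndex N) :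
    (I.shift j).unshift i = (I.unshift i).shift j := by
  funext k
  by_cases hk : k = i
  · subst hk
    simp [MultiIndex.shift, MultiIndex.unshift, h.symm]
  · simp [MultiIndex.shift, MultiIndex.unshift, hk]

/-- The centred coordinate has total derivatives 0 or 1, so the Leibniz rule stops after one term.
If `I i = 0`, the truncated `I.unshift i` is harmless, since its coefficient vanishes. -/
theorem totalDerivPow_centeredCoord_mul (p : Jet N) (i : Fin N) (I : MultiIndex N) (f : Loc N) :
    totalDerivPow I (centeredCoord p (Sum.inl i) * f) =
      centeredCoord p (Sum.inl i) * totalDerivPow I f +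
        (I i : ℝ) • totalDerivPow (I.unshift i) f := by
  induction I using MultiIndex.induction_shift with
  | zero => simp [totalDerivPow_zero]
  | shift j I ih =>
    rw [totalDerivPow_shift_apply, ih, map_add, map_smul, totalDeriv_mul,
      totalDeriv_centeredCoord, totalDerivPow_shift_apply]
    by_cases h : j = i
    · subst h
      rw [if_pos rfl, one_mul, MultiIndex.unshift_shift, MultiIndex.shift_apply_self]
      push_cast
      rw [add_smul, one_smul]
      by_cases hj : I j = 0
      · simp [hj, add_comm]
      · rw [← totalDerivPow_shift_apply, ← totalDerivPow_shift_apply j (I.unshift j),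
          MultiIndex.shift_unshift hj]
        abel
    · rw [if_neg h, zero_mul, zero_add, MultiIndex.shift_apply_of_ne h,
        MultiIndex.shift_unshift_comm h, totalDerivPow_shift_apply]

theorem vertDerivPow_centeredCoord_mul (p : Jet N) (J : MultiIndex N) (α : MultiIndex N →₀ ℕ)
    (f : Loc N) :
    vertDerivPow α (centeredCoord p (Sum.inr J) * f) =
      centeredCoord p (Sum.inr J) * vertDerivPow α f +
        (α J : ℝ) • vertDerivPow (α - Finsupp.single J 1) f := by
  induction α using finsupp_induction_add_single with
  | zero => simp [vertDerivPow_zero]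
  | add_single K α ih =>
    rw [vertDerivPow_add_single_apply, ih, map_add, map_smul, pderiv_mul,
      pderiv_centeredCoord, vertDerivPow_add_single_apply]
    by_cases h : K = J
    · subst h
      rw [if_pos rfl, one_mul, add_tsub_cancel_right, Finsupp.add_apply, Finsupp.single_eq_same]
      push_cast
      rw [add_smul, one_smul]
      by_cases hK : α K = 0
      · simp [hK, add_comm]
      · have hle : Finsupp.single K 1 ≤ α := by
          rw [Finsupp.single_le_iff]
          omega
        rw [← vertDerivPow_add_single_apply,
          ← vertDerivPow_add_single_apply (α - Finsupp.single K 1), tsub_add_cancel_of_le hle]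
        abel
    · have e : α + Finsupp.single K 1 - Finsupp.single J 1 =
          α - Finsupp.single J 1 + Finsupp.single K 1 := by
        ext L
        by_cases hL : L = J
        · subst hL
          simp [h]
        · simp [Finsupp.single_apply, Ne.symm hL]
      rw [if_neg (by simpa using h), zero_mul, zero_add, e, vertDerivPow_add_single_apply]
      simp [h]

theorem vertDerivPow_one (α : MultiIndex N →₀ ℕ) :
    vertDerivPow α (1 : Loc N) = if α = 0 then 1 else 0 := by
  induction α using finsupp_induction_add_single with
  | zero => simp [vertDerivPow_zero]
  | add_single K α ih =>
    have h : α + Finsupp.single K 1 ≠ 0 := fun h => by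
      have := DFunLike.congr_fun h K
      simp at this
    rw [vertDerivPow_add_single_apply, ih, if_neg h]
    split_ifs
    · exact pderiv_one _
    · exact map_zero _

theorem vertDerivPow_eq_zero {α : MultiIndex N →₀ ℕ} {J : MultiIndex N} (hJ : α J ≠ 0) {f : Loc N}
    (hf : pderiv (Sum.inr J) f = 0) : vertDerivPow α f = 0 := by
  rw [vertDerivPow, ← Finset.noncommProd_erase_mul _ (Finsupp.mem_support_iff.2 hJ)]
  obtain ⟨m, hm⟩ := Nat.exists_eq_succ_of_ne_zero hJ
  rw [hm, pow_succ]
  simp [Module.End.mul_apply, hf]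

theorem vertDerivPow_mul_of_pderiv_eq_zero {h : Loc N} (hh : ∀ J, pderiv (Sum.inr J) h = 0)
    (α : MultiIndex N →₀ ℕ) (f : Loc N) : vertDerivPow α (h * f) = h * vertDerivPow α f := by
  induction α using finsupp_induction_add_single with
  | zero => simp [vertDerivPow_zero]
  | add_single K α ih =>
    rw [vertDerivPow_add_single_apply, ih, pderiv_mul, hh, zero_mul, zero_add,
      vertDerivPow_add_single_apply]

/-- The witness is `∏ (u_J - p_J)^{α(J)}`, with `C = ∏ α(J)!`. Its independence of the other `u_K`
later disposes of the terms of higher formal degree. -/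
theorem exists_vertical_test (p : Jet N) (α : MultiIndex N →₀ ℕ) :
    ∃ (h : Loc N) (C : ℝ), C ≠ 0 ∧ (∀ K, α K = 0 → pderiv (Sum.inr K) h = 0) ∧
      ∀ β, evalAt p (vertDerivPow β h) = if β = α then C else 0 := by
  induction α using finsupp_induction_add_single with
  | zero =>
    refine ⟨1, 1, one_ne_zero, fun _ _ => pderiv_one _, fun β => ?_⟩
    rw [vertDerivPow_one]
    split_ifs
    · exact evalAt_one p
    · exact map_zero _
  | add_single J α ih =>
    obtain ⟨h, C, hC, h0, hβ⟩ := ih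
    refine ⟨centeredCoord p (Sum.inr J) * h, C * (α J + 1), by positivity, fun K hK => ?_,
      fun β => ?_⟩
    · have hKJ : K ≠ J := by
        rintro rfl
        simp at hK
      rw [pderiv_mul, pderiv_centeredCoord, if_neg (by simpa using hKJ), zero_mul, zero_add,
        h0 K (by simp at hK; exact hK.1), mul_zero]
    · rw [vertDerivPow_centeredCoord_mul, map_add, map_smul, evalAt_mul, evalAt_centeredCoord,
        zero_mul, zero_add, hβ]
      by_cases hb : β = α + Finsupp.single J 1
      · subst hb
        simp [mul_comm]
      · rw [if_neg hb]
        by_cases hJ : β J = 0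
        · simp [hJ]
        · rw [if_neg, smul_zero]
          rintro rfl
          refine hb (tsub_add_cancel_of_le ?_).symm
          rw [Finsupp.single_le_iff]
          omega

theorem MultiIndex.order_eq_zero {I : MultiIndex N} : I.order = 0 ↔ I = 0 := by
  constructor
  · intro h
    funext i
    simpa using (Finset.sum_eq_zero_iff.1 h) i (Finset.mem_univ i)
  · rintro rfl
    simp [MultiIndex.order]

/-- The witness is `∏ (x^i - p^i)^{I_i}`, with `C = ∏ I_i!`. The bound on `K.order` is needed
because derivatives of higher order can also fall on `g`. -/
theorem exists_horizontal_test (p : Jet N) (I : MultiIndex N) :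
    ∃ (h : Loc N) (C : ℝ), C ≠ 0 ∧ (∀ K, pderiv (Sum.inr K) h = 0) ∧
      ∀ (g : Loc N) (K : MultiIndex N), K.order ≤ I.order →
        evalAt p (totalDerivPow K (h * g)) = if K = I then C * evalAt p g else 0 := by
  induction I using MultiIndex.induction_shift with
  | zero =>
    refine ⟨1, 1, one_ne_zero, fun _ => pderiv_one _, fun g K hK => ?_⟩
    obtain rfl : K = 0 := by
      rw [MultiIndex.order_eq_zero.2 rfl] at hK
      exact MultiIndex.order_eq_zero.1 (by omega)
    simp [totalDerivPow_zero]
  | shift i I ih =>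
    obtain ⟨h, C, hC, h0, hg⟩ := ih
    refine ⟨centeredCoord p (Sum.inl i) * h, C * (I i + 1), by positivity, fun K => ?_,
      fun g K hK => ?_⟩
    · rw [pderiv_mul, pderiv_centeredCoord, if_neg (by simp), zero_mul, zero_add, h0, mul_zero]
    · rw [mul_assoc, totalDerivPow_centeredCoord_mul, map_add, map_smul, evalAt_mul,
        evalAt_centeredCoord, zero_mul, zero_add]
      by_cases hi : K i = 0
      · rw [if_neg, hi, Nat.cast_zero, zero_smul]
        rintro rfl
        simp [MultiIndex.shift_apply_self] at hi
      · obtain ⟨L, rfl⟩ : ∃ L : MultiIndex N, K = L.shift i :=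
          ⟨_, (MultiIndex.shift_unshift hi).symm⟩
        simp only [MultiIndex.order_shift] at hK
        rw [MultiIndex.unshift_shift, hg g L (by omega), MultiIndex.shift_apply_self]
        simp only [(MultiIndex.shift_injective i).eq_iff]
        split_ifs with h
        · subst h
          push_cast
          rw [smul_eq_mul]
          ring
        · simp

end TestFunctions

/-! ### Coefficients are determined by the operator. -/

section Uniqueness

variable {N : ℕ}

namespace LDOSymbol

/-- Among the nonzero coefficients of formal degree at most `n` (finitely many), one whose `I₀` has
maximal order is isolated by the product of a horizontal and a vertical test function at an
arbitrary point. -/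
theorem coeff_eq_zero_of_toEnd_eq_zero {σ : LDOSymbol N} (hσ : σ.toEnd = 0) (I : MultiIndex N)
    (α : MultiIndex N →₀ ℕ) : σ.coeff I α = 0 := by
  by_contra hne
  set n := formalDegree α
  obtain ⟨⟨I₀, α₀⟩, hmem, hmax⟩ := (σ.finite_coeff n).toFinset.exists_max_image
    (fun c => c.1.order) ⟨(I, α), by simpa using ⟨hne, le_rfl⟩⟩
  rw [Set.Finite.mem_toFinset] at hmem
  refine hmem.1 (Subtype.ext (funext fun p => ?_))
  change evalAt p (σ.coeff I₀ α₀) = 0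
  obtain ⟨h, C, hC, h0, hval⟩ := exists_horizontal_test p I₀
  obtain ⟨h', C', hC', h0', hval'⟩ := exists_vertical_test p α₀
  have key : evalAt p (σ.toEnd (h * h')) = 0 := by rw [hσ]; simp
  rw [toEnd_apply, map_finsum _ (σ.finite_support _), finsum_eq_single _ (I₀, α₀)] at key
  · rw [evalAt_mul, vertDerivPow_mul_of_pderiv_eq_zero h0, hval _ _ le_rfl, if_pos rfl, hval',
      if_pos rfl] at key
    simpa [hC, hC'] using key
  · rintro ⟨J, β⟩ hne'
    rw [evalAt_mul, vertDerivPow_mul_of_pderiv_eq_zero h0]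
    by_cases hβ : formalDegree β ≤ n
    · by_cases hc : σ.coeff J β = 0
      · simp [hc]
      · rw [hval _ _ (hmax (J, β) (by simpa using ⟨hc, hβ⟩)), hval']
        split_ifs with h1 h2
        · exact absurd (Prod.ext h1 h2) hne'
        · simp
        · simp
    -- Beyond formal degree `n`, `β` differentiates in some `u_K` on which `h'` does not depend.
    · obtain ⟨K, hK, hlt⟩ := Finset.lt_sup_iff.1 (not_le.1 hβ)
      have hK' : α₀ K = 0 := by
        by_contra hK'
        have : K.order ≤ formalDegree α₀ :=
          Finset.le_sup (f := MultiIndex.order) (Finsupp.mem_support_iff.2 hK')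
        exact absurd (this.trans hmem.2) (not_le.2 hlt)
      rw [vertDerivPow_eq_zero (Finsupp.mem_support_iff.1 hK) (h0' K hK')]
      simp

theorem toEnd_injective : Function.Injective (toEnd : LDOSymbol N → Module.End ℝ (Loc N)) := by
  intro σ τ h
  ext1 I α
  have h1 := toEnd_sum_fintype fun b : Bool => cond b σ (smul (-1) τ)
  have h2 := coeff_eq_zero_of_toEnd_eq_zero (h1.trans (by
    rw [Fintype.sum_bool, cond_true, cond_false, toEnd_smul, h]
    exact (congrArg (τ.toEnd + ·) (neg_one_smul ℝ τ.toEnd)).trans (add_neg_cancel τ.toEnd))) I α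
  rw [sum_coeff, finsum_eq_sum_of_fintype, Fintype.sum_bool] at h2
  have h3 : σ.coeff I α + (-1 : ℝ) • τ.coeff I α = 0 := h2
  rw [neg_one_smul] at h3
  exact add_neg_eq_zero.1 h3

end LDOSymbol

/-- By uniqueness the symbol picked by `choose` is `σ` itself, so `chi` can be computed from any
known symbol. -/
theorem chi_toEnd (σ : LDOSymbol N) : chi σ.toEnd = σ.char.toEnd := by
  have h : IsLDO σ.toEnd := ⟨σ, rfl⟩
  rw [chi, dif_pos h, LDOSymbol.toEnd_injective h.choose_spec.symm]

end Uniqueness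

/-! ### Divergences, commutators with total derivatives, and integration by parts. -/

section Operations

variable {N : ℕ} {ι : Type*}

open LDOSymbol

theorem LDOSymbol.coeff_sum_eq_zero {τ : ι → LDOSymbol N} (h : LocallyFinite τ)
    {I : MultiIndex N} {α : MultiIndex N →₀ ℕ} (h0 : ∀ i, (τ i).coeff I α = 0) :
    (sum τ h).coeff I α = 0 :=
  finsum_eq_zero_of_forall_eq_zero h0

theorem LDOSymbol.exists_coeff_ne_zero {τ : ι → LDOSymbol N} (h : LocallyFinite τ)
    {I : MultiIndex N} {α : MultiIndex N →₀ ℕ} (h0 : (sum τ h).coeff I α ≠ 0) :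
    ∃ i, (τ i).coeff I α ≠ 0 := by
  by_contra! h1
  exact h0 (coeff_sum_eq_zero h h1)

theorem LDOSymbol.toEnd_eq_zero {σ : LDOSymbol N} (h : ∀ I α, σ.coeff I α = 0) :
    σ.toEnd = 0 := by
  ext1 f
  rw [toEnd_apply]
  exact finsum_eq_zero_of_forall_eq_zero fun c => by rw [h, zero_mul]

theorem LDOSymbol.single_zero_coeff (I I' : MultiIndex N) (α α' : MultiIndex N →₀ ℕ) :
    (single I α (0 : Loc N)).coeff I' α' = 0 := by
  simp [single_coeff]

theorem LDOSymbol.toEnd_single_zero (I : MultiIndex N) (α : MultiIndex N →₀ ℕ) :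
    (single I α (0 : Loc N)).toEnd = 0 :=
  toEnd_eq_zero fun _ _ => single_zero_coeff _ _ _ _

theorem LDOSymbol.eq_of_single_coeff_ne_zero {I I' : MultiIndex N} {α α' : MultiIndex N →₀ ℕ}
    {p : Loc N} (h : (single I α p).coeff I' α' ≠ 0) : I' = I ∧ α' = α :=
  Prod.ext_iff.1 (of_not_not fun h' => h (if_neg h'))

theorem IsLDO.zero : IsLDO (0 : Module.End ℝ (Loc N)) :=
  ⟨single 0 0 0, (toEnd_single_zero 0 0).symm⟩

theorem IsLDO.smul {A : Module.End ℝ (Loc N)} (hA : IsLDO A) (r : ℝ) : IsLDO (r • A) := by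
  obtain ⟨σ, rfl⟩ := hA
  exact ⟨LDOSymbol.smul r σ, (toEnd_smul r σ).symm⟩

theorem chi_smul {A : Module.End ℝ (Loc N)} (hA : IsLDO A) (r : ℝ) :
    chi (r • A) = r • chi A := by
  obtain ⟨σ, rfl⟩ := hA
  rw [← toEnd_smul, chi_toEnd, chi_toEnd, char_smul, toEnd_smul]

theorem IsLDO.sum [Fintype ι] {A : ι → Module.End ℝ (Loc N)} (hA : ∀ i, IsLDO (A i)) :
    IsLDO (∑ i, A i) := by
  choose σ hσ using hA
  obtain rfl : A = _ := funext hσ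
  exact ⟨_, (toEnd_sum_fintype σ).symm⟩

theorem chi_sum [Fintype ι] {A : ι → Module.End ℝ (Loc N)} (hA : ∀ i, IsLDO (A i)) :
    chi (∑ i, A i) = ∑ i, chi (A i) := by
  choose σ hσ using hA
  obtain rfl : A = _ := funext hσ
  rw [← toEnd_sum_fintype, chi_toEnd, char_sum, toEnd_sum_fintype]
  simp only [chi_toEnd]

theorem IsLDO.add {A B : Module.End ℝ (Loc N)} (hA : IsLDO A) (hB : IsLDO B) :
    IsLDO (A + B) := by
  have := IsLDO.sum (A := fun b : Bool => cond b A B) (by rintro (_ | _) <;> assumption)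
  simpa using this

theorem chi_add {A B : Module.End ℝ (Loc N)} (hA : IsLDO A) (hB : IsLDO B) :
    chi (A + B) = chi A + chi B := by
  have := chi_sum (A := fun b : Bool => cond b A B) (by rintro (_ | _) <;> assumption)
  simpa using this

theorem IsLDO.chi {A : Module.End ℝ (Loc N)} (hA : IsLDO A) : IsLDO (chi A) := by
  obtain ⟨σ, rfl⟩ := hA
  exact ⟨σ.char, chi_toEnd σ⟩

/-- On a monomial the Leibniz rule yields coefficients `d/dx^i p` at `I` and `p` at `iI`. Their
contributions to the characteristic are equal up to the sign `(-1)^{|I|+1} = -(-1)^{|I|}` and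
cancel. -/
theorem exists_symbol_totalDeriv_comp (i : Fin N) (σ : LDOSymbol N) :
    ∃ τ : LDOSymbol N, τ.toEnd = totalDeriv i ∘ₗ σ.toEnd ∧ τ.char.toEnd = 0 := by
  set τ : MultiIndex N × (MultiIndex N →₀ ℕ) → LDOSymbol N := fun c =>
    LDOSymbol.sum (fun b : Bool => cond b (single c.1 c.2 (totalDeriv i (σ.coeff c.1 c.2)))
      (single (c.1.shift i) c.2 (σ.coeff c.1 c.2))) (.of_finite _)
  have hτ : LocallyFinite τ := by
    refine locallyFinite_of_coeff σ (fun c hc I α => ?_) (fun c I α hc => ?_)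
    · refine coeff_sum_eq_zero _ ?_
      rintro (_ | _) <;> simp [hc, single_zero_coeff]
    · obtain ⟨_ | _, hb⟩ := exists_coeff_ne_zero _ hc
      all_goals
        rw [(eq_of_single_coeff_ne_zero hb).2]
        omega
  refine ⟨LDOSymbol.sum τ hτ, ?_, ?_⟩
  · ext1 f
    rw [toEnd_sum_apply, LinearMap.comp_apply, toEnd_eq_finsum_single,
      map_finsum _ (σ.locallyFinite_single.finite_support_toEnd f)]
    refine finsum_congr fun c => ?_
    simp only [τ, toEnd_sum_fintype, Fintype.sum_bool, cond_true, cond_false,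
      LinearMap.add_apply, toEnd_single_apply, totalDeriv_mul, totalDerivPow_shift_apply]
  · refine toEnd_eq_zero fun I α => ?_
    rw [char_sum]
    refine coeff_sum_eq_zero _ fun c => ?_
    simp only [τ]
    rw [char_sum, sum_coeff, finsum_eq_sum_of_fintype, Fintype.sum_bool]
    simp only [cond_true, cond_false, char_single, single_coeff]
    split_ifs
    · rw [MultiIndex.order_shift, totalDerivPow_totalDeriv, totalDerivPow_shift_apply, pow_succ,
        mul_neg_one, neg_smul, add_neg_cancel]
    · exact add_zero 0

theorem IsLDO.totalDeriv_comp {A : Module.End ℝ (Loc N)} (hA : IsLDO A) (i : Fin N) :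
    IsLDO (totalDeriv i ∘ₗ A) := by
  obtain ⟨σ, rfl⟩ := hA
  obtain ⟨τ, hτ, -⟩ := exists_symbol_totalDeriv_comp i σ
  exact ⟨τ, hτ.symm⟩

/-- The characteristic of a total divergence vanishes. -/
theorem chi_totalDeriv_comp {A : Module.End ℝ (Loc N)} (hA : IsLDO A) (i : Fin N) :
    chi (totalDeriv i ∘ₗ A) = 0 := by
  obtain ⟨σ, rfl⟩ := hA
  obtain ⟨τ, hτ, hτ0⟩ := exists_symbol_totalDeriv_comp i σ
  rw [← hτ, chi_toEnd, hτ0]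

theorem formalDegree_add_single (α : MultiIndex N →₀ ℕ) (J : MultiIndex N) :
    formalDegree (α + Finsupp.single J 1) = max (formalDegree α) J.order := by
  classical
  have : (α + Finsupp.single J 1).support = insert J α.support := by
    ext K
    by_cases h : K = J
    · simp [h]
    · simp [h]
  rw [formalDegree, this, Finset.sup_insert, max_comm]
  rfl

/-- Each factor `∂/∂u_K` that passes `d/dx^i` leaves a term in which `K` has lost one `i`. The
degree bound keeps the commutator of a whole symbol locally finite. -/
theorem exists_vertDerivPow_totalDeriv (i : Fin N) (α : MultiIndex N →₀ ℕ) :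
    ∃ (n : ℕ) (b : Fin n → (MultiIndex N →₀ ℕ)),
      (∀ k, formalDegree α ≤ formalDegree (b k) + 1) ∧
      ∀ f, vertDerivPow α (totalDeriv i f) =
        totalDeriv i (vertDerivPow α f) + ∑ k, vertDerivPow (b k) f := by
  induction α using finsupp_induction_add_single with
  | zero => exact ⟨0, Fin.elim0, fun k => k.elim0, fun f => by simp [vertDerivPow_zero]⟩
  | add_single K α ih =>
    obtain ⟨n, b, hb, h⟩ := ih
    have hdeg : ∀ k, formalDegree (α + Finsupp.single K 1) ≤
        formalDegree (b k + Finsupp.single K 1) + 1 := fun k => by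
      have := hb k
      simp only [formalDegree_add_single]
      omega
    by_cases hK : K i = 0
    · refine ⟨n, fun k => b k + Finsupp.single K 1, hdeg, fun f => ?_⟩
      simp only [vertDerivPow_add_single_apply, h, map_add, map_sum, pderiv_totalDeriv_inr]
      simp [vertLower, hK]
    · refine ⟨n + 1, Fin.cons (α + Finsupp.single (K.unshift i) 1)
        fun k => b k + Finsupp.single K 1, fun k => ?_, fun f => ?_⟩
      · refine Fin.cases ?_ hdeg k
        have := MultiIndex.order_unshift hK
        rw [Fin.cons_zero, formalDegree_add_single, formalDegree_add_single]
        omega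
      · rw [Fin.sum_univ_succ]
        simp only [vertDerivPow_add_single_apply, h, map_add, map_sum, pderiv_totalDeriv_inr,
          Fin.cons_zero, Fin.cons_succ, vertLower, if_neg hK, add_assoc]

/-- The commutator of an LDO with `d/dx^i` is an LDO, and it contains no total derivatives if the
LDO does not contain any. -/
theorem exists_symbol_commutator (i : Fin N) (σ : LDOSymbol N) :
    ∃ τ : LDOSymbol N, τ.toEnd + totalDeriv i ∘ₗ σ.toEnd = σ.toEnd ∘ₗ totalDeriv i ∧
      ((∀ I α, I ≠ 0 → σ.coeff I α = 0) → ∀ I α, I ≠ 0 → τ.coeff I α = 0) := by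
  choose n b hb hcomm using exists_vertDerivPow_totalDeriv (N := N) i
  -- In the commutator of a monomial, `none` indexes the derivative of the coefficient and `some k`
  -- the terms left by the vertical derivatives.
  set τ : MultiIndex N × (MultiIndex N →₀ ℕ) → LDOSymbol N := fun c =>
    LDOSymbol.sum (fun k : Option (Fin (n c.2)) => k.elim
      (single c.1 c.2 (-totalDeriv i (σ.coeff c.1 c.2)))
      (fun k => single c.1 (b c.2 k) (σ.coeff c.1 c.2))) (.of_finite _)
  have hτ0 : ∀ c, σ.coeff c.1 c.2 = 0 → ∀ I α, (τ c).coeff I α = 0 := fun c hc I α => by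
    refine coeff_sum_eq_zero _ ?_
    rintro (_ | _) <;> simp [hc, single_zero_coeff]
  have hτ : LocallyFinite τ := by
    refine locallyFinite_of_coeff σ hτ0 (fun c I α hc => ?_)
    obtain ⟨_ | k, hk⟩ := exists_coeff_ne_zero _ hc
    all_goals rw [(eq_of_single_coeff_ne_zero hk).2]
    · omega
    · exact hb _ _
  refine ⟨LDOSymbol.sum τ hτ, ?_, fun hσ I α hI => coeff_sum_eq_zero _ fun c => ?_⟩
  · ext1 f
    rw [LinearMap.add_apply, toEnd_sum_apply, LinearMap.comp_apply, LinearMap.comp_apply,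
      toEnd_eq_finsum_single σ f,
      map_finsum _ (σ.locallyFinite_single.finite_support_toEnd f),
      ← finsum_add_distrib (hτ.finite_support_toEnd f)
        ((σ.locallyFinite_single.finite_support_toEnd f).subset
          fun c hc h0 => hc (by simp only [h0, map_zero])),
      toEnd_eq_finsum_single σ (totalDeriv i f)]
    refine finsum_congr fun c => ?_
    simp only [τ, toEnd_sum_fintype, Fintype.sum_option, Option.elim_none, Option.elim_some,
      LinearMap.add_apply, LinearMap.sum_apply, toEnd_single_apply, totalDeriv_mul, hcomm, map_add,
      map_sum, mul_add, Finset.mul_sum, totalDerivPow_totalDeriv]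
    ring
  · by_contra hc
    obtain ⟨k, hk⟩ := exists_coeff_ne_zero _ hc
    have : I = c.1 := by
      rcases k with _ | k
      · exact (eq_of_single_coeff_ne_zero hk).1
      · exact (eq_of_single_coeff_ne_zero hk).1
    exact hc (hτ0 c (hσ _ _ (this ▸ hI)) _ _)

theorem IsLDO.comp_totalDeriv {A : Module.End ℝ (Loc N)} (hA : IsLDO A) (i : Fin N) :
    IsLDO (A ∘ₗ totalDeriv i) := by
  have hA' := hA.totalDeriv_comp i
  obtain ⟨σ, rfl⟩ := hA
  obtain ⟨τ, hτ, -⟩ := exists_symbol_commutator i σ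
  rw [← hτ]
  exact IsLDO.add ⟨τ, rfl⟩ hA'

theorem LDOSymbol.char_eq_self {σ : LDOSymbol N} (hσ : ∀ I α, I ≠ 0 → σ.coeff I α = 0) :
    σ.char = σ := by
  ext1 I α
  rw [char_coeff]
  split_ifs with hI
  · subst hI
    rw [finsum_eq_single _ 0 fun K hK => by rw [hσ K α hK, map_zero, smul_zero]]
    simp [MultiIndex.order, totalDerivPow_zero]
  · exact (hσ I α hI).symm

theorem LDOSymbol.char_coeff_of_ne_zero (σ : LDOSymbol N) (I : MultiIndex N)
    (α : MultiIndex N →₀ ℕ) (hI : I ≠ 0) : σ.char.coeff I α = 0 :=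
  if_neg hI

/-- The commutator of `chi A` with `d/dx^i` contains no total derivatives, so `chi` fixes it, while
`chi` kills `totalDeriv i ∘ₗ chi A`. -/
theorem chi_chi_comp_totalDeriv {A : Module.End ℝ (Loc N)} (hA : IsLDO A) (i : Fin N) :
    chi (chi A ∘ₗ totalDeriv i) + totalDeriv i ∘ₗ chi A = chi A ∘ₗ totalDeriv i := by
  have hD := hA.chi.totalDeriv_comp i
  have hD0 := chi_totalDeriv_comp hA.chi i
  obtain ⟨σ, rfl⟩ := hA
  rw [chi_toEnd] at hD hD0 ⊢
  obtain ⟨τ, hτ, hv⟩ := exists_symbol_commutator i σ.char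
  conv_rhs => rw [← hτ]
  rw [← hτ, chi_add ⟨τ, rfl⟩ hD, hD0, add_zero, chi_toEnd,
    char_eq_self (hv σ.char_coeff_of_ne_zero)]

/-- Integration by parts: with D for the total derivatives, `p D_j D^I ∂^α = D_j (p D^I ∂^α) - (D_j
p) D^I ∂^α`. The induction is over all `p`, as `p` becomes `D_j p`. That only `α` occurs in `B`
allows summation over all monomials. -/
theorem exists_single_eq_char_add_divergence (I : MultiIndex N) (α : MultiIndex N →₀ ℕ)
    (p : Loc N) : ∃ B : Fin N → LDOSymbol N,
      (single I α p).toEnd = (single I α p).char.toEnd + ∑ i, totalDeriv i ∘ₗ (B i).toEnd ∧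
      ∀ i J β, (B i).coeff J β ≠ 0 → β = α := by
  induction I using MultiIndex.induction_shift generalizing p with
  | zero =>
    refine ⟨fun _ => single 0 0 0, ?_, fun i J β h => absurd (single_zero_coeff _ _ _ _) h⟩
    rw [char_eq_self fun J β hJ => ?_]
    · simp [toEnd_single_zero]
    · by_contra h
      exact hJ (eq_of_single_coeff_ne_zero h).1
  | shift j I ih =>
    obtain ⟨B, hB, hα⟩ := ih (totalDeriv j p)
    refine ⟨fun i => LDOSymbol.sum (fun b : Bool =>
      cond b (single I α (if i = j then p else 0)) (LDOSymbol.smul (-1) (B i))) (.of_finite _),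
      ?_, fun i J β h => ?_⟩
    · have h1 : (single (I.shift j) α p).char.toEnd =
          -(single I α (totalDeriv j p)).char.toEnd := by
        ext1 f
        rw [LinearMap.neg_apply, char_single, char_single, toEnd_single_apply, toEnd_single_apply,
          MultiIndex.order_shift, totalDerivPow_totalDeriv, totalDerivPow_shift_apply, pow_succ,
          mul_neg_one, neg_smul]
        exact neg_mul (_ : Loc N) _
      have h2 : ∑ i, totalDeriv i ∘ₗ (single I α (if i = j then p else 0)).toEnd =
          totalDeriv j ∘ₗ (single I α p).toEnd := by
        rw [Finset.sum_eq_single j]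
        · rw [if_pos rfl]
        · intro i _ hi
          rw [if_neg hi, toEnd_single_zero, LinearMap.comp_zero]
        · simp
      have h3 : (single (I.shift j) α p).toEnd =
          totalDeriv j ∘ₗ (single I α p).toEnd - (single I α (totalDeriv j p)).toEnd := by
        ext1 f
        simp only [LinearMap.sub_apply, LinearMap.comp_apply, toEnd_single_apply, totalDeriv_mul,
          totalDerivPow_shift_apply]
        ring
      simp only [toEnd_sum_fintype, Fintype.sum_bool, cond_true, cond_false, toEnd_smul,
        LinearMap.comp_add, LinearMap.comp_smul, Finset.sum_add_distrib, h1, h2, h3, hB,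
        ← Finset.smul_sum]
      have e : (-1 : ℝ) • ∑ i, totalDeriv i ∘ₗ (B i).toEnd = -∑ i, totalDeriv i ∘ₗ (B i).toEnd := by
        ext1 f
        exact neg_one_smul ℝ ((∑ i, totalDeriv i ∘ₗ (B i).toEnd) f)
      rw [e]
      abel
    · obtain ⟨_ | _, hb⟩ := exists_coeff_ne_zero _ h
      · refine hα i J β fun h0 => hb ?_
        change (-1 : ℝ) • (B i).coeff J β = 0
        rw [h0, smul_zero]
      · exact (eq_of_single_coeff_ne_zero hb).2

/-- An LDO is the sum of its characteristic and a total divergence. -/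
theorem exists_eq_chi_add_divergence {A : Module.End ℝ (Loc N)} (hA : IsLDO A) :
    ∃ B : Fin N → Module.End ℝ (Loc N), (∀ i, IsLDO (B i)) ∧
      A = chi A + ∑ i, totalDeriv i ∘ₗ B i := by
  obtain ⟨σ, rfl⟩ := hA
  -- The last clause forces `B = 0` where the coefficient of `σ` vanishes; without it the chosen
  -- family need not be locally finite.
  have hex : ∀ c : MultiIndex N × (MultiIndex N →₀ ℕ), ∃ B : Fin N → LDOSymbol N,
      (single c.1 c.2 (σ.coeff c.1 c.2)).toEnd = (single c.1 c.2 (σ.coeff c.1 c.2)).char.toEnd +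
        ∑ i, totalDeriv i ∘ₗ (B i).toEnd ∧ (∀ i J β, (B i).coeff J β ≠ 0 → β = c.2) ∧
      (σ.coeff c.1 c.2 = 0 → ∀ i J β, (B i).coeff J β = 0) := by
    intro c
    by_cases hc : σ.coeff c.1 c.2 = 0
    · refine ⟨fun _ => single 0 0 0, ?_, fun _ _ _ h => absurd (single_zero_coeff _ _ _ _) h,
        fun _ _ _ _ => single_zero_coeff _ _ _ _⟩
      rw [hc, char_single]
      simp [toEnd_single_zero]
    · obtain ⟨B, hB, hα⟩ := exists_single_eq_char_add_divergence c.1 c.2 (σ.coeff c.1 c.2)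
      exact ⟨B, hB, hα, fun h => absurd h hc⟩
  choose B hB hα h0 using hex
  have hfin : ∀ i, LocallyFinite fun c => B c i := fun i =>
    locallyFinite_of_coeff σ (fun c hc => h0 c hc i) fun c I α hc => by
      rw [hα c i I α hc]
      omega
  refine ⟨fun i => (LDOSymbol.sum _ (hfin i)).toEnd, fun i => ⟨_, rfl⟩, ?_⟩
  rw [chi_toEnd]
  have hchar : σ.char = LDOSymbol.sum _ σ.locallyFinite_single.char := by
    rw [← char_sum _ σ.locallyFinite_single, sum_single]
  have hsupp : ∀ i f, (Function.support fun c => totalDeriv i ((B c i).toEnd f)).Finite :=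
    fun i f => ((hfin i).finite_support_toEnd f).subset fun c hc h => hc (by simp only [h, map_zero])
  ext1 f
  rw [toEnd_eq_finsum_single, LinearMap.add_apply, hchar, toEnd_sum_apply, LinearMap.sum_apply]
  simp only [hB, LinearMap.comp_apply, toEnd_sum_apply]
  rw [Finset.sum_congr rfl fun i _ => map_finsum _ ((hfin i).finite_support_toEnd f),
    ← finsum_sum_comm _ _ fun i _ => hsupp i f,
    ← finsum_add_distrib (σ.locallyFinite_single.char.finite_support_toEnd f)]
  · simp only [LinearMap.add_apply, LinearMap.sum_apply, LinearMap.comp_apply]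
  · refine (Set.finite_iUnion fun i => hsupp i f).subset fun c hc => ?_
    obtain ⟨i, -, hi⟩ := Finset.exists_ne_zero_of_sum_ne_zero hc
    exact Set.mem_iUnion.2 ⟨i, hi⟩

/-- `χ(A ∘ d/dx^i)` is the commutator of `χ(A)` with `d/dx^i`. -/
theorem chi_comp_totalDeriv {A : Module.End ℝ (Loc N)} (hA : IsLDO A) (i : Fin N) :
    chi (A ∘ₗ totalDeriv i) + totalDeriv i ∘ₗ chi A = chi A ∘ₗ totalDeriv i := by
  obtain ⟨B, hB, h⟩ := exists_eq_chi_add_divergence hA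
  -- Composed with `d/dx^i` on the right, the divergence part of `A` is still a divergence, so `A`
  -- may be replaced by `chi A`.
  have e : A ∘ₗ totalDeriv i = chi A ∘ₗ totalDeriv i +
      ∑ j, totalDeriv j ∘ₗ (B j ∘ₗ totalDeriv i) := by
    conv_lhs => rw [h]
    ext1 f
    simp only [LinearMap.add_apply, LinearMap.sum_apply, LinearMap.comp_apply]
  have hB' := fun j => (hB j).comp_totalDeriv i
  rw [e, chi_add (hA.chi.comp_totalDeriv i) (.sum fun j => (hB' j).totalDeriv_comp j),
    chi_sum fun j => (hB' j).totalDeriv_comp j,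
    Finset.sum_eq_zero fun j _ => chi_totalDeriv_comp (hB' j) j, add_zero,
    chi_chi_comp_totalDeriv hA]

end Operations

/-! ### The horizontal complex, contractions and the construction of the lift. -/

section Forms

variable {N k : ℕ}

/-- The sign of `dx^i ∧ dx^{T \ i}` relative to `dx^T`. -/
def wedgeSign (T : Finset (Fin N)) (i : Fin N) : ℝ := (-1) ^ (T.filter (fun j => j < i)).card

theorem wedgeSign_mul_self (T : Finset (Fin N)) (i : Fin N) :
    wedgeSign T i * wedgeSign T i = 1 := by
  rw [wedgeSign, ← mul_pow]
  simp

theorem wedgeSign_ne_zero (T : Finset (Fin N)) (i : Fin N) : wedgeSign T i ≠ 0 :=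
  left_ne_zero_of_mul_eq_one (wedgeSign_mul_self T i)

theorem wedgeSign_erase_of_le {T : Finset (Fin N)} {i j : Fin N} (h : i ≤ j) :
    wedgeSign (T.erase j) i = wedgeSign T i := by
  rw [wedgeSign, wedgeSign, Finset.filter_erase, Finset.erase_eq_of_notMem]
  simp [h]

theorem wedgeSign_erase_of_lt {T : Finset (Fin N)} {i j : Fin N} (hi : i ∈ T) (h : i < j) :
    wedgeSign (T.erase i) j = -wedgeSign T j := by
  have : i ∈ T.filter (fun k => k < j) := by simp [hi, h]
  rw [wedgeSign, wedgeSign, Finset.filter_erase, ← Finset.card_erase_add_one this, pow_succ]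
  ring

/-- The coefficient of `dx^S` in a form, for arbitrary `S`. -/
def formCoeff (w : HForm N k) (S : Finset (Fin N)) : Loc N :=
  if h : S.card = k then w ⟨S, h⟩ else 0

theorem dH_apply (w : HForm N k) (T : {T : Finset (Fin N) // T.card = k + 1}) :
    dH w T = ∑ i : {i // i ∈ T.1}, wedgeSign T.1 i.1 • totalDeriv i.1
      (w ⟨T.1.erase i.1, by rw [Finset.card_erase_of_mem i.2, T.2, Nat.add_sub_cancel]⟩) := by
  simp [dH, wedgeSign]

/-- With `formCoeff` the summand carries no cardinality proof, so double sums can be rearranged. -/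
theorem dH_eq_sum (w : HForm N k) (T : {T : Finset (Fin N) // T.card = k + 1}) :
    dH w T = ∑ i ∈ T.1, wedgeSign T.1 i • totalDeriv i (formCoeff w (T.1.erase i)) := by
  rw [dH_apply, ← Finset.sum_coe_sort T.1 fun i =>
    wedgeSign T.1 i • totalDeriv i (formCoeff w (T.1.erase i))]
  refine Finset.sum_congr rfl fun i _ => ?_
  rw [formCoeff, dif_pos]

/-- The terms of `(i, j)` and `(j, i)` cancel: total derivatives commute, and removing the smaller
index flips the sign of the larger one but not conversely. -/
theorem dH_comp_dH : (dH : HForm N (k + 1) →ₗ[ℝ] HForm N (k + 2)) ∘ₗ dH = 0 := by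
  refine LinearMap.ext fun w => funext fun T => ?_
  change dH (dH w) T = 0
  have e : ∀ i ∈ T.1, formCoeff (dH w) (T.1.erase i) = ∑ j ∈ T.1.erase i,
      wedgeSign (T.1.erase i) j • totalDeriv j (formCoeff w ((T.1.erase i).erase j)) := by
    intro i hi
    rw [formCoeff, dif_pos (by rw [Finset.card_erase_of_mem hi, T.2, Nat.add_sub_cancel]),
      dH_eq_sum]
  rw [dH_eq_sum, Finset.sum_congr rfl fun i hi => by rw [e i hi, map_sum, Finset.smul_sum],
    Finset.sum_sigma']
  have key : ∀ i ∈ T.1, ∀ j ∈ T.1, i < j →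
      wedgeSign T.1 i • totalDeriv i (wedgeSign (T.1.erase i) j •
        totalDeriv j (formCoeff w ((T.1.erase i).erase j))) +
      wedgeSign T.1 j • totalDeriv j (wedgeSign (T.1.erase j) i •
        totalDeriv i (formCoeff w ((T.1.erase j).erase i))) = 0 := by
    intro i hi j hj hij
    rw [wedgeSign_erase_of_lt hi hij, wedgeSign_erase_of_le hij.le, map_smul, map_smul,
      totalDeriv_apply_comm j i, Finset.erase_right_comm, smul_smul, smul_smul, ← add_smul]
    rw [mul_neg, mul_comm, neg_add_cancel, zero_smul]
  refine Finset.sum_involution (fun a _ => ⟨a.2, a.1⟩) ?_ ?_ ?_ ?_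
  · rintro ⟨i, j⟩ h
    simp only [Finset.mem_sigma, Finset.mem_erase] at h
    rcases lt_or_gt_of_ne h.2.1 with hlt | hlt
    · rw [add_comm]
      exact key j h.2.2 i h.1 hlt
    · exact key i h.1 j h.2.2 hlt
  · rintro ⟨i, j⟩ h _ h'
    simp only [Finset.mem_sigma, Finset.mem_erase] at h
    exact h.2.1 (Sigma.mk.inj_iff.1 h').1
  · rintro ⟨i, j⟩ h
    simp only [Finset.mem_sigma, Finset.mem_erase] at h ⊢
    exact ⟨h.2.2, h.2.1.symm, h.1⟩
  · rintro ⟨i, j⟩ h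
    rfl

/-- The operator `f dx^U ↦ ∑_{i ∈ U} ± B_i(f) dx^{U \ i}`. -/
def contraction (B : Fin N → Module.End ℝ (Loc N)) : HForm N (k + 1) →ₗ[ℝ] HForm N k :=
  LinearMap.pi fun T => ∑ i : {i // i ∉ T.1}, wedgeSign T.1 i.1 •
    (B i.1 ∘ₗ LinearMap.proj (R := ℝ)
      (⟨insert i.1 T.1, by rw [Finset.card_insert_of_notMem i.2, T.2]⟩ :
          {S : Finset (Fin N) // S.card = k + 1}))

theorem contraction_apply (B : Fin N → Module.End ℝ (Loc N)) (w : HForm N (k + 1))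
    (T : {T : Finset (Fin N) // T.card = k}) :
    contraction B w T = ∑ i : {i // i ∉ T.1}, wedgeSign T.1 i.1 •
      B i.1 (w ⟨insert i.1 T.1, by rw [Finset.card_insert_of_notMem i.2, T.2]⟩) := by
  simp [contraction]

theorem contraction_zero :
    (contraction fun _ => 0 : HForm N (k + 1) →ₗ[ℝ] HForm N k) = 0 := by
  refine LinearMap.ext fun w => funext fun T => ?_
  simp [contraction_apply]

theorem eq_top (T : {T : Finset (Fin N) // T.card = N}) : T = ⟨Finset.univ, by simp⟩ :=
  Subtype.ext ((Finset.card_eq_iff_eq_univ _).1 (by simp [T.2]))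

instance : Subsingleton {T : Finset (Fin N) // T.card = N} :=
  ⟨fun S T => (eq_top S).trans (eq_top T).symm⟩

theorem apply_eq_topOp (A : HForm N N →ₗ[ℝ] HForm N N) (w : HForm N N)
    (T : {T : Finset (Fin N) // T.card = N}) : A w T = topOp A (w T) := by
  obtain rfl := eq_top T
  have : w = Pi.single ⟨Finset.univ, by simp⟩ (w ⟨Finset.univ, by simp⟩) := by
    funext S
    obtain rfl := Subsingleton.elim S ⟨Finset.univ, by simp⟩
    simp
  conv_lhs => rw [this]
  rfl

/-- Once `i` is removed from the full index set, only `i` can be put back; the two wedge signs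
coincide and square to one. -/
theorem dH_contraction (B : Fin (k + 1) → Module.End ℝ (Loc (k + 1))) (w : HForm (k + 1) (k + 1))
    (T : {T : Finset (Fin (k + 1)) // T.card = k + 1}) :
    dH (contraction B w) T = ∑ i, totalDeriv i (B i (w T)) := by
  obtain rfl := eq_top T
  rw [dH_apply, ← Finset.sum_coe_sort Finset.univ fun i =>
    totalDeriv i (B i (w ⟨Finset.univ, by simp⟩))]
  refine Finset.sum_congr rfl fun i _ => ?_
  rw [contraction_apply, Finset.sum_eq_single ⟨i.1, by simp⟩]
  · rw [map_smul, smul_smul, wedgeSign_erase_of_le le_rfl, wedgeSign_mul_self, one_smul]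
    congr 3
    exact Subsingleton.elim _ _
  · rintro ⟨j, hj⟩ _ hne
    exact absurd (Subtype.ext (by simpa using hj)) hne
  · simp

theorem dH_comp_diagOp {Q : Module.End ℝ (Loc N)}
    (hQ : ∀ i, totalDeriv i ∘ₗ Q = Q ∘ₗ totalDeriv i) :
    (dH : HForm N k →ₗ[ℝ] HForm N (k + 1)) ∘ₗ diagOp Q = diagOp Q ∘ₗ dH := by
  refine LinearMap.ext fun w => funext fun T => ?_
  change dH (diagOp Q w) T = Q (dH w T)
  rw [dH_apply, dH_apply, map_sum]
  refine Finset.sum_congr rfl fun i _ => ?_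
  rw [map_smul]
  exact congrArg _ (LinearMap.congr_fun (hQ i) _)

theorem IsLDO.comp_proj_single {C : Module.End ℝ (Loc N)} (hC : IsLDO C)
    (S U : {S : Finset (Fin N) // S.card = k}) :
    IsLDO (C ∘ₗ LinearMap.proj (R := ℝ) U ∘ₗ LinearMap.single ℝ (fun _ => Loc N) S) := by
  by_cases h : S = U
  · subst h
    convert hC
    ext1 f
    simp
  · convert IsLDO.zero
    ext1 f
    simp [Ne.symm h]

theorem IsFormLDO.add {l : ℕ} {A B : HForm N k →ₗ[ℝ] HForm N l} (hA : IsFormLDO A)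
    (hB : IsFormLDO B) : IsFormLDO (A + B) :=
  fun S T => (hA S T).add (hB S T)

theorem IsLDO.isFormLDO_diagOp {Q : Module.End ℝ (Loc N)} (hQ : IsLDO Q) :
    IsFormLDO (diagOp Q : HForm N k →ₗ[ℝ] HForm N k) :=
  fun S T => hQ.comp_proj_single S T

theorem isFormLDO_contraction_comp_dH {B : Fin N → Module.End ℝ (Loc N)} (hB : ∀ i, IsLDO (B i)) :
    IsFormLDO (contraction B ∘ₗ dH : HForm N k →ₗ[ℝ] HForm N k) := by
  intro S T
  have : ∀ i : {i // i ∉ T.1}, IsLDO (B i.1 ∘ₗ matrixEntry dH S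
      ⟨insert i.1 T.1, by rw [Finset.card_insert_of_notMem i.2, T.2]⟩) := by
    intro i
    convert IsLDO.sum fun j : {j // j ∈ insert i.1 T.1} =>
      (((hB i.1).comp_totalDeriv j.1).comp_proj_single S ⟨(insert i.1 T.1).erase j.1, by
        rw [Finset.card_erase_of_mem j.2, Finset.card_insert_of_notMem i.2, T.2,
          Nat.add_sub_cancel]⟩).smul (wedgeSign (insert i.1 T.1) j.1) using 1
    ext1 f
    change B i.1 (dH _ _) = _
    rw [dH_apply, map_sum, LinearMap.sum_apply]
    exact Finset.sum_congr rfl fun j _ => map_smul _ _ _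
  convert IsLDO.sum fun i => (this i).smul (wedgeSign T.1 i.1) using 1
  ext1 f
  change contraction B _ T = _
  rw [contraction_apply, LinearMap.sum_apply]
  rfl

theorem IsFormLDO.dH_comp {l : ℕ} {A : HForm N k →ₗ[ℝ] HForm N l} (hA : IsFormLDO A) :
    IsFormLDO (dH ∘ₗ A) := by
  intro S T
  convert IsLDO.sum fun i : {i // i ∈ T.1} => ((hA S ⟨T.1.erase i.1, by
    rw [Finset.card_erase_of_mem i.2, T.2, Nat.add_sub_cancel]⟩).totalDeriv_comp i.1).smul
      (wedgeSign T.1 i.1) using 1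
  ext1 f
  change dH _ T = _
  rw [dH_apply, LinearMap.sum_apply]
  rfl

theorem isFormLDO_contraction {B : Fin N → Module.End ℝ (Loc N)} (hB : ∀ i, IsLDO (B i)) :
    IsFormLDO (contraction B : HForm N (k + 1) →ₗ[ℝ] HForm N k) := by
  intro S T
  convert IsLDO.sum fun i : {i // i ∉ T.1} => ((hB i.1).comp_proj_single S
    ⟨insert i.1 T.1, by rw [Finset.card_insert_of_notMem i.2, T.2]⟩).smul
      (wedgeSign T.1 i.1) using 1
  ext1 f
  change contraction B _ T = _
  rw [contraction_apply, LinearMap.sum_apply]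
  rfl

theorem chi_dH_comp {l : ℕ} {A : HForm N k →ₗ[ℝ] HForm N l} (hA : IsFormLDO A)
    (S : {S : Finset (Fin N) // S.card = k}) (T : {T : Finset (Fin N) // T.card = l + 1}) :
    chi (matrixEntry (dH ∘ₗ A) S T) = 0 := by
  have hE : ∀ i : {i // i ∈ T.1}, IsLDO (totalDeriv i.1 ∘ₗ matrixEntry A S ⟨T.1.erase i.1, by
      rw [Finset.card_erase_of_mem i.2, T.2, Nat.add_sub_cancel]⟩) :=
    fun i => (hA _ _).totalDeriv_comp _
  have e : matrixEntry (dH ∘ₗ A) S T = ∑ i : {i // i ∈ T.1}, wedgeSign T.1 i.1 •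
      (totalDeriv i.1 ∘ₗ matrixEntry A S ⟨T.1.erase i.1, by
        rw [Finset.card_erase_of_mem i.2, T.2, Nat.add_sub_cancel]⟩) := by
    ext1 f
    change dH _ T = _
    rw [dH_apply, LinearMap.sum_apply]
    rfl
  rw [e, chi_sum fun i => (hE i).smul _]
  refine Finset.sum_eq_zero fun i _ => ?_
  rw [chi_smul (hE i), chi_totalDeriv_comp (hA _ _), smul_zero]

/-- The operators `Q + [d_H, H]`, where `Q` acts diagonally and `H` is nonzero only on forms of
top degree, where it is the contraction with the operators `B_i`. -/
def homotopyLift (Q : Module.End ℝ (Loc N)) (B : Fin N → Module.End ℝ (Loc N)) :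
    ∀ s : ℕ, HForm N s →ₗ[ℝ] HForm N s
  -- Each condition tests whether the source of the contraction has degree `N`. In degree 0 there is
  -- no term `dH ∘ₗ contraction`, for lack of forms of degree -1.
  | 0 => diagOp Q + contraction (if 1 = N then B else fun _ => 0) ∘ₗ dH
  | s + 1 => diagOp Q + contraction (if s + 2 = N then B else fun _ => 0) ∘ₗ dH +
      dH ∘ₗ contraction (if s + 1 = N then B else fun _ => 0)

/-- Since `dH` squares to zero, both sides reduce to `diagOp Q ∘ₗ dH` plus the same term `dH ∘ₗ
contraction _ ∘ₗ dH`. -/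
theorem dH_comp_homotopyLift {Q : Module.End ℝ (Loc N)} (B : Fin N → Module.End ℝ (Loc N))
    (hQ : ∀ i, totalDeriv i ∘ₗ Q = Q ∘ₗ totalDeriv i) (s : ℕ) :
    dH ∘ₗ homotopyLift Q B s = homotopyLift Q B (s + 1) ∘ₗ dH := by
  have h1 : ∀ s (w : HForm N s), dH (dH w) = 0 := fun s w => LinearMap.congr_fun dH_comp_dH w
  have h2 : ∀ s (w : HForm N s), dH (diagOp Q w) = diagOp Q (dH w) :=
    fun s w => LinearMap.congr_fun (dH_comp_diagOp hQ) w
  refine LinearMap.ext fun w => ?_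
  cases s <;>
  simp only [homotopyLift, LinearMap.comp_apply, LinearMap.add_apply, map_add, h1, h2, map_zero,
    add_zero]

theorem isFormLDO_homotopyLift {Q : Module.End ℝ (Loc N)} {B : Fin N → Module.End ℝ (Loc N)}
    (hQ : IsLDO Q) (hB : ∀ i, IsLDO (B i)) (s : ℕ) : IsFormLDO (homotopyLift Q B s) := by
  have hB' : ∀ (p : Prop) [Decidable p] (i : Fin N), IsLDO ((if p then B else fun _ => 0) i) := by
    intro p _ i
    split_ifs
    · exact hB i
    · exact IsLDO.zero
  cases s with
  | zero => exact hQ.isFormLDO_diagOp.add (isFormLDO_contraction_comp_dH (hB' _))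
  | succ s =>
    exact (hQ.isFormLDO_diagOp.add (isFormLDO_contraction_comp_dH (hB' _))).add
      (isFormLDO_contraction (hB' _)).dH_comp

theorem homotopyLift_of_le (Q : Module.End ℝ (Loc N)) (B : Fin N → Module.End ℝ (Loc N)) {s : ℕ}
    (hs : s + 2 ≤ N) : homotopyLift Q B s = diagOp Q := by
  cases s with
  | zero =>
    rw [homotopyLift, if_neg (by omega), contraction_zero, LinearMap.zero_comp, add_zero]
  | succ s =>
    rw [homotopyLift, if_neg (by omega), if_neg (by omega), contraction_zero, contraction_zero,
      LinearMap.zero_comp, LinearMap.comp_zero, add_zero, add_zero]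

theorem homotopyLift_top (Q : Module.End ℝ (Loc N)) (B : Fin N → Module.End ℝ (Loc N))
    {A : HForm N N →ₗ[ℝ] HForm N N} (hA : topOp A = Q + ∑ i, totalDeriv i ∘ₗ B i) :
    homotopyLift Q B N = A := by
  refine LinearMap.ext fun w => funext fun T => ?_
  rw [apply_eq_topOp A, hA]
  cases N with
  | zero =>
    rw [homotopyLift, if_neg (by omega), contraction_zero, LinearMap.zero_comp, add_zero]
    simp [diagOp]
  | succ M =>
    rw [homotopyLift, if_neg (by omega), if_pos rfl, contraction_zero, LinearMap.zero_comp,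
      add_zero]
    simp only [LinearMap.add_apply, LinearMap.sum_apply, LinearMap.comp_apply, Pi.add_apply]
    rw [dH_contraction]
    rfl

/-- An operator on top degree forms which has a lift maps total divergences to total
divergences. -/
theorem IsLift.chi_eq_zero {A : HForm N N →ₗ[ℝ] HForm N N} (hA : IsFormLDO A)
    {L : ∀ s : ℕ, HForm N s →ₗ[ℝ] HForm N s} (hL : IsLift A L) (i : Fin N) :
    chi (topOp A ∘ₗ totalDeriv i) = 0 := by
  cases N with
  | zero => exact i.elim0
  | succ M =>
    set S : {S : Finset (Fin (M + 1)) // S.card = M} := ⟨Finset.univ.erase i, by simp⟩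
    set T : {S : Finset (Fin (M + 1)) // S.card = M + 1} := ⟨Finset.univ, by simp⟩
    have hA' : IsLDO (topOp A) := hA _ _
    have h0 := chi_dH_comp (hL.isLDO M (by omega)) S T
    -- As `S` omits only `i`, `dH` sends `f dx^S` to `± (d/dx^i f) dx^T`.
    have e : matrixEntry (A ∘ₗ dH) S T = wedgeSign T.1 i • (topOp A ∘ₗ totalDeriv i) := by
      ext1 f
      change A (dH (Pi.single S f)) T = _
      rw [apply_eq_topOp, dH_apply, Finset.sum_eq_single ⟨i, by simp [T]⟩]
      · rw [map_smul]
        change _ • topOp A (totalDeriv i ((Pi.single S f : HForm (M + 1) M) S)) = _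
        rw [Pi.single_eq_same]
        rfl
      · intro j _ hj
        rw [Pi.single_eq_of_ne, map_zero, smul_zero]
        intro h
        have h' : j.1 ∉ S.1 := by
          rw [← h]
          exact Finset.notMem_erase _ _
        exact hj (Subtype.ext (by simpa [S] using h'))
      · simp
    rw [hL.comm M (by omega), hL.top, e, chi_smul (hA'.comp_totalDeriv i)] at h0
    exact (smul_eq_zero.1 h0).resolve_left (wedgeSign_ne_zero _ _)

theorem exists_isLift {A : HForm N N →ₗ[ℝ] HForm N N} (hA : IsFormLDO A)
    (h : ∀ i : Fin N, chi (topOp A ∘ₗ totalDeriv i) = 0) :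
    ∃ L : ∀ s : ℕ, HForm N s →ₗ[ℝ] HForm N s, IsLift A L ∧
      ∀ s : ℕ, s + 2 ≤ N → L s = diagOp (chi (topOp A)) := by
  have hA' : IsLDO (topOp A) := hA _ _
  obtain ⟨B, hB, hAB⟩ := exists_eq_chi_add_divergence hA'
  -- The hypothesis enters only here, as the vanishing of a commutator.
  have hQ : ∀ i, totalDeriv i ∘ₗ chi (topOp A) = chi (topOp A) ∘ₗ totalDeriv i := fun i => by
    rw [← chi_comp_totalDeriv hA' i, h i, zero_add]
  exact ⟨homotopyLift (chi (topOp A)) B,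
    ⟨homotopyLift_top _ B hAB, fun s _ => isFormLDO_homotopyLift hA'.chi hB s,
      fun s _ => dH_comp_homotopyLift B hQ s⟩, fun s hs => homotopyLift_of_le _ B hs⟩

end Forms

end

end VarBicomplex

theorem corollary3p2 (N : ℕ)
    (A : VarBicomplex.HForm N N →ₗ[ℝ] VarBicomplex.HForm N N)
    (hA : VarBicomplex.IsFormLDO A) :
    ((∃ L : ∀ s : ℕ, VarBicomplex.HForm N s →ₗ[ℝ] VarBicomplex.HForm N s,
        VarBicomplex.IsLift A L) ↔
      ∀ i : Fin N,
        VarBicomplex.chi (VarBicomplex.topOp A ∘ₗ VarBicomplex.totalDeriv i) = 0) ∧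
    ((∀ i : Fin N,
        VarBicomplex.chi (VarBicomplex.topOp A ∘ₗ VarBicomplex.totalDeriv i) = 0) →
      ∃ L : ∀ s : ℕ, VarBicomplex.HForm N s →ₗ[ℝ] VarBicomplex.HForm N s,
        VarBicomplex.IsLift A L ∧
        ∀ s : ℕ, s + 2 ≤ N → L s = VarBicomplex.diagOp (VarBicomplex.chi (VarBicomplex.topOp A))) := by
  refine ⟨⟨fun ⟨L, hL⟩ i => hL.chi_eq_zero hA i, fun h => ?_⟩,
    fun h => VarBicomplex.exists_isLift hA h⟩
  obtain ⟨L, hL, -⟩ := VarBicomplex.exists_isLift hA h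
  exact ⟨L, hL⟩
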